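/- **Notation.** Let $\mathbb T=[-\pi,\pi]$; functions on $\mathbb T$ are identified with their $2\pi$-periodic extensions to $\mathbb R$. A *weight* is a $2\pi$-periodic measurable function $\gamma$ with values in $[0,\infty]$ that is positive a.e. on $\mathbb T$; write $\gamma(A)=\int_A\gamma(t)\,dt$. The class $A\mathfrak S_p^1$, $1\le p\le\infty$, is defined as follows. * For $1<p<\infty$: $\gamma\in A\mathfrak S_p^1$ iff $\gamma$ is integrable on $\mathbb T$, is doubling (there is $C$ with $\gamma(2I)\le C\gamma(I)$ for all intervals $I\subseteq\mathbb T$, where $2I$ is the interval with the same midpoint and twice the length), and $$\sup_{J\subseteq\mathbb T}\frac{\gamma(J)}{|J|}\Big(\frac1{|J|}\int_J\gamma(u)^{-1/(p-1)}\,du\Big)^{p-1}<\infty ,$$ the supremum being over all nondegenerate intervals $J\subseteq\mathbb T$. * For $p=1$: $\gamma\in A\mathfrak S_1^1$ iff $\sup_{J\subseteq\mathbb T}\gamma(J)/|J|<\infty$ and there is $c>0$ with $\gamma\ge c$ a.e. on $\mathbb T$. * For $p=\infty$: $\gamma\equiv1$ (a.e.). $L_{p,\gamma}$ is the space of measurable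 $f:\mathbb T\to\mathbb R$ with $\|f\|_{p,\gamma}<\infty$, where $\|f\|_{p,\gamma}=\big(\int_{\mathbb T}|f|^p\gamma\,dx\big)^{1/p}$ for $p<\infty$ and $\|f\|_{\infty,\gamma}=\operatorname{ess\,sup}_{\mathbb T}|f|$. For $v>0$ let $\mathfrak T_vf(x)=\frac1v\int_x^{x+v}f(t)\,dt$, and for $k\in\mathbb N$ let $\Omega_k(f,v)_{p,\gamma}=\|(\mathbb I-\mathfrak T_v)^kf\|_{p,\gamma}$, where $\mathbb I$ is the identity. Let $\Pi_n$ be the set of real trigonometric polynomials of degree at most $n$ (constant term included) and $E_n(f)_{p,\gamma}=\inf_{U\in\Pi_n}\|f-U\|_{p,\gamma}$. For $\beta>0$ let $\mathrm{Lip}\,\beta(p,\gamma)$ be the set of $f\in L_{p,\gamma}$ for which there is a finite constant $C$ with $\Omega_{\lfloor\beta\rfloor+1}(f,\delta)_{p,\gamma}\le C\delta^\beta$ for all $\delta>0$. **Theorem.** Let $\beta>0$, $1\le p\le\infty$, $\gamma\in A\mathfrak S_p^1$ and $f\in L_{p,\gamma}$. Then $f\in\mathrm{Lip}\,\beta(p,\gamma)$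 if and only if there is a finite constant $C$ such that $E_n(f)_{p,\gamma}\le C\,n^{-\beta}$ for all integers $n\ge1$. -/

import Mathlib

open MeasureTheory
open scoped ENNReal NNReal

noncomputable section

namespace WeightedTrig

/-- The mass `γ(A) = ∫_A γ(t) dt`. -/
def mass (γ : ℝ → ℝ≥0∞) (A : Set ℝ) : ℝ≥0∞ := ∫⁻ t in A, γ t

/-- A `2π`-periodic weight: (Lebesgue) measurable, with values in `[0, ∞]`, positive a.e. on
`𝕋 = [-π, π]`.  Functions on `𝕋` are identified with their `2π`-periodic extensions to `ℝ`. -/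
structure IsWeight (γ : ℝ → ℝ≥0∞) : Prop where
  aemeasurable : AEMeasurable γ volume
  periodic : Function.Periodic γ (2 * Real.pi)
  pos : ∀ᵐ x ∂volume.restrict (Set.Icc (-Real.pi) Real.pi), 0 < γ x

/-- The doubling property for an integrable periodic weight: `γ(2I) ≤ C γ(I)` for all intervals
`I = [a, b] ⊆ 𝕋`, where `2I` has the midpoint of `I` and twice its length. -/
structure IsDoubling (γ : ℝ → ℝ≥0∞) : Prop where
  isWeight : IsWeight γ
  integrable : mass γ (Set.Icc (-Real.pi) Real.pi) < ∞
  doubling : ∃ C : ℝ≥0, ∀ a b : ℝ, -Real.pi ≤ a → a < b → b ≤ Real.pi →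
    mass γ (Set.Icc ((a + b) / 2 - (b - a)) ((a + b) / 2 + (b - a)))
      ≤ C * mass γ (Set.Icc a b)

/-- The Muckenhoupt constant `[γ]_p`, `1 < p < ∞`, a supremum over intervals `J = [a, b] ⊆ 𝕋`. -/
def muckenhouptConst (p : ℝ) (γ : ℝ → ℝ≥0∞) : ℝ≥0∞ :=
  ⨆ (a : ℝ) (b : ℝ) (_ : -Real.pi ≤ a ∧ a < b ∧ b ≤ Real.pi),
    (mass γ (Set.Icc a b) / ENNReal.ofReal (b - a)) *
      ((∫⁻ u in Set.Icc a b, (γ u) ^ (-1 / (p - 1))) / ENNReal.ofReal (b - a)) ^ (p - 1)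

/-- The Muckenhoupt class `A_p`, `1 < p < ∞`. -/
def MuckenhouptAp (p : ℝ) (γ : ℝ → ℝ≥0∞) : Prop :=
  IsDoubling γ ∧ muckenhouptConst p γ < ∞

/-- The constant `[γ]_1 = sup γ(J) / mes(J)` over intervals `J = [a, b] ⊆ 𝕋`. -/
def meanConst (γ : ℝ → ℝ≥0∞) : ℝ≥0∞ :=
  ⨆ (a : ℝ) (b : ℝ) (_ : -Real.pi ≤ a ∧ a < b ∧ b ≤ Real.pi),
    mass γ (Set.Icc a b) / ENNReal.ofReal (b - a)

/-- The class `𝔖₁`: bounded means, and `γ ≥ c > 0` a.e. on `𝕋`. -/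
def ClassS1 (γ : ℝ → ℝ≥0∞) : Prop :=
  IsWeight γ ∧ meanConst γ < ∞ ∧
    ∃ c : ℝ≥0, 0 < c ∧ ∀ᵐ x ∂volume.restrict (Set.Icc (-Real.pi) Real.pi), (c : ℝ≥0∞) ≤ γ x

/-- The class `A𝔖_p^1`: `𝔖₁` for `p = 1`, `A_p` for `1 < p < ∞`, and `γ ≡ 1` for `p = ∞`
(equality almost everywhere). -/
def ClassAS (p : ℝ≥0∞) (γ : ℝ → ℝ≥0∞) : Prop :=
  (p = 1 ∧ ClassS1 γ) ∨
  (1 < p ∧ p < ∞ ∧ MuckenhouptAp p.toReal γ) ∨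
  (p = ∞ ∧ IsWeight γ ∧ ∀ᵐ x ∂(volume : Measure ℝ), γ x = 1)

/-- The measure `γ(x) dx` on `𝕋 = [-π, π]`. -/
def weightedMeasure (γ : ℝ → ℝ≥0∞) : Measure ℝ :=
  (volume.restrict (Set.Icc (-Real.pi) Real.pi)).withDensity γ

/-- The norm `‖f‖_{p,γ}` with values in `[0, ∞]`.  As `γ > 0` a.e., for `p = ∞` the essential
supremum for `γ(x) dx` is the one for Lebesgue measure on `𝕋`. -/
def wnorm (p : ℝ≥0∞) (γ : ℝ → ℝ≥0∞) (f : ℝ → ℝ) : ℝ≥0∞ :=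
  eLpNorm f p (weightedMeasure γ)

/-- The weighted Lebesgue space `L_{p,γ}` of (`2π`-periodically extended) real functions on `𝕋`. -/
def wLp (p : ℝ≥0∞) (γ : ℝ → ℝ≥0∞) : Set (ℝ → ℝ) :=
  {f | Function.Periodic f (2 * Real.pi) ∧ MemLp f p (weightedMeasure γ)}

/-- The one-sided Steklov mean `𝔗_v f(x) = (1/v) ∫_x^{x+v} f(t) dt`, `𝔗_0 f = f`. -/
def steklov (v : ℝ) (f : ℝ → ℝ) : ℝ → ℝ := fun x =>
  if v = 0 then f x else (1 / v) * ∫ t in x..(x + v), f t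

/-- The operator `𝕀 - 𝔗_v`. -/
def steklovDiff (v : ℝ) (f : ℝ → ℝ) : ℝ → ℝ := fun x => f x - steklov v f x

/-- The modulus of smoothness `Ω_k(f, v)_{p,γ} = ‖(𝕀 - 𝔗_v)^k f‖_{p,γ}`. -/
def Omega (k : ℕ) (f : ℝ → ℝ) (v : ℝ) (p : ℝ≥0∞) (γ : ℝ → ℝ≥0∞) : ℝ≥0∞ :=
  wnorm p γ ((steklovDiff v)^[k] f)

/-- The class `Π_n` of real trigonometric polynomials of degree at most `n` (the term `k = 0` is
the constant term). -/
def trigPoly (n : ℕ) : Set (ℝ → ℝ) :=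
  {U | ∃ a b : ℕ → ℝ, ∀ x, U x =
    ∑ k ∈ Finset.range (n + 1), (a k * Real.cos (k * x) + b k * Real.sin (k * x))}

/-- The best approximation error `E_n(f)_{p,γ} = inf_{U ∈ Π_n} ‖f - U‖_{p,γ}`. -/
def bestApprox (n : ℕ) (f : ℝ → ℝ) (p : ℝ≥0∞) (γ : ℝ → ℝ≥0∞) : ℝ≥0∞ :=
  ⨅ U ∈ trigPoly n, wnorm p γ (fun x => f x - U x)

/-- The Lipschitz class `Lip β (p, γ)`: those `f ∈ L_{p,γ}` for which there is a finite `C` with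
`Ω_{⌊β⌋+1}(f, δ)_{p,γ} ≤ C δ^β` for all `δ > 0`. -/
def LipClass (β : ℝ) (p : ℝ≥0∞) (γ : ℝ → ℝ≥0∞) : Set (ℝ → ℝ) :=
  {f | f ∈ wLp p γ ∧ ∃ C : ℝ≥0, ∀ δ : ℝ, 0 < δ →
    Omega (⌊β⌋₊ + 1) f δ p γ ≤ C * ENNReal.ofReal (δ ^ β)}

end WeightedTrig

end

noncomputable section
namespace WeightedTrig
open Real (pi pi_pos)

/-! The only property of the weight that matters is that the averages `avg v` are bounded on L_{p,γ}
uniformly in v (`Admissible`). Whatever is dominated pointwise by such an average, or by a sum of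
averages with summable coefficients, is then bounded in norm. No maximal function or conjugate
function enters, so the endpoints p = 1 and p = ∞ need no separate approximation argument. For
finite p the bound on averages follows by cutting the circle into cells of length comparable to v: a
reverse Jensen inequality holds on each cell, and neighbouring cells have comparable mass.

Write T for the Steklov mean of step v. Two estimates come from dyadic bounds on the Fejér kernel: a
Bernstein inequality, ‖(1 - T)U‖ ≤ c·vn‖U‖ for U of degree at most n, and a Jackson inequality, by
which a C¹ function g is within (c/N)‖g'‖ of the trigonometric polynomials of degree at most N.

Direct part. Since (1 + T)^k (1 - T)^k = 1 - T²S with S a polynomial in T, f differs from T²Sf by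
O(Ω_k(f, v)). For U of degree m ≤ N, T²SU again has degree at most m, while T²S(f - U) is C¹ with
derivative O(‖f - U‖/v). Jackson's inequality gives E_N(f) ≤ K₁ Ω_k(f, v) + K₂/(Nv)·‖f - U‖
(`bestApprox_le_omega_add`). With v = A/N, A large, and U nearly best of degree ⌊N/2⌋, the last term
is absorbed by induction on N. One derivative therefore suffices for every k and β.

Inverse part. This is Bernstein's telescoping argument along nearly best approximants of degree 2^j.
The hypothesis β < k makes the top dyadic level dominate. -/

/-! ### Periodic functions and integrals over translated intervals. -/

theorem iUnion_periods : (⋃ n : ℤ, Set.Icc (-pi + n * (2 * pi)) (pi + n * (2 * pi))) = Set.univ := by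
  refine Set.eq_univ_of_forall fun x => Set.mem_iUnion.2 ⟨⌊(x + pi) / (2 * pi)⌋, ?_, ?_⟩
  · have := Int.floor_le ((x + pi) / (2 * pi))
    rw [le_div_iff₀ (by positivity)] at this
    linarith
  · have := (Int.lt_floor_add_one ((x + pi) / (2 * pi))).le
    rw [div_le_iff₀ (by positivity)] at this
    linarith

theorem measurePreserving_shift_period (n : ℤ) :
    MeasurePreserving (fun x : ℝ => x - n * (2 * pi))
      (volume.restrict (Set.Icc (-pi + n * (2 * pi)) (pi + n * (2 * pi))))
      (volume.restrict (Set.Icc (-pi) pi)) := by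
  have h := (measurePreserving_sub_right (volume : Measure ℝ) ((n : ℝ) * (2 * pi))).restrict_preimage
    (s := Set.Icc (-pi) pi) measurableSet_Icc
  have e : (fun x : ℝ => x - (n : ℝ) * (2 * pi)) ⁻¹' Set.Icc (-pi) pi =
      Set.Icc (-pi + n * (2 * pi)) (pi + n * (2 * pi)) := by
    ext x
    simp only [Set.mem_preimage, Set.mem_Icc]
    constructor <;> rintro ⟨h1, h2⟩ <;> constructor <;> linarith
  rwa [e] at h

/-- The line is a countable union of translates of 𝕋, and a translation by a period preserves null
sets. -/
theorem ae_of_periodic {P : ℝ → Prop} (hP : Function.Periodic P (2 * pi))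
    (h : ∀ᵐ x ∂volume.restrict (Set.Icc (-pi) pi), P x) : ∀ᵐ x, P x := by
  rw [← Measure.restrict_univ (μ := (volume : Measure ℝ)), ← iUnion_periods, ae_restrict_iUnion_iff]
  intro n
  filter_upwards [(measurePreserving_shift_period n).quasiMeasurePreserving.ae h] with x hx
  rwa [hP.sub_int_mul_eq] at hx

theorem aemeasurable_of_periodic {E : Type*} [MeasurableSpace E] {f : ℝ → E}
    (hf : Function.Periodic f (2 * pi))
    (h : AEMeasurable f (volume.restrict (Set.Icc (-pi) pi))) : AEMeasurable f volume := by
  rw [← Measure.restrict_univ (μ := (volume : Measure ℝ)), ← iUnion_periods, aemeasurable_iUnion_iff]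
  intro n
  have := AEMeasurable.comp_quasiMeasurePreserving h (measurePreserving_shift_period n).quasiMeasurePreserving
  refine this.congr (Filter.Eventually.of_forall fun x => ?_)
  exact hf.sub_int_mul_eq n

theorem lintegral_Icc_add (w : ℝ → ℝ≥0∞) (a b x : ℝ) :
    ∫⁻ t in Set.Icc a b, w (x + t) = ∫⁻ t in Set.Icc (x + a) (x + b), w t := by
  have h := (measurePreserving_add_left (volume : Measure ℝ) x).setLIntegral_comp_preimage_emb
    (MeasurableEquiv.addLeft x).measurableEmbedding w (Set.Icc (x + a) (x + b))
  rw [← h]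
  congr 2
  ext t
  simp

theorem lintegral_Icc_add_period {w : ℝ → ℝ≥0∞} (hw : Function.Periodic w (2 * pi)) (a b : ℝ) :
    ∫⁻ t in Set.Icc (a + 2 * pi) (b + 2 * pi), w t = ∫⁻ t in Set.Icc a b, w t := by
  rw [add_comm a, add_comm b, ← lintegral_Icc_add]
  simp only [add_comm (2 * pi)]
  exact lintegral_congr fun t => hw t

theorem lintegral_Icc_split (w : ℝ → ℝ≥0∞) {a b c : ℝ} (hab : a ≤ b) (hbc : b ≤ c) :
    ∫⁻ t in Set.Icc a c, w t = (∫⁻ t in Set.Icc a b, w t) + ∫⁻ t in Set.Icc b c, w t := by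
  simp only [setLIntegral_congr (Ioc_ae_eq_Icc (μ := volume)).symm]
  rw [← Set.Ioc_union_Ioc_eq_Ioc hab hbc, lintegral_union measurableSet_Ioc
    (Set.Ioc_disjoint_Ioc_of_le le_rfl)]

theorem lintegral_Icc_sum (w : ℝ → ℝ≥0∞) (c h : ℝ) (hh : 0 ≤ h) (n : ℕ) :
    ∫⁻ t in Set.Icc c (c + n * h), w t =
      ∑ j ∈ Finset.range n, ∫⁻ t in Set.Icc (c + j * h) (c + (j + 1) * h), w t := by
  induction n with
  | zero => simp
  | succ n ih =>
    rw [Finset.sum_range_succ, ← ih, lintegral_Icc_split w (b := c + n * h)]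
    · push_cast; rfl
    · have : 0 ≤ (n : ℝ) * h := by positivity
      linarith
    · push_cast; linarith

/-! ### Averages and the reduction of long windows to one period. -/

/-- The two-sided average of a nonnegative function, normalised by the half-length. -/
def avg (v : ℝ) (u : ℝ → ℝ≥0∞) (x : ℝ) : ℝ≥0∞ :=
  (ENNReal.ofReal v)⁻¹ * ∫⁻ t in Set.Icc (-v) v, u (x + t)

/-- True measurability results from a.e. measurability because the window integral does not change
when u is altered on a null set. -/
theorem measurable_window {u : ℝ → ℝ≥0∞} (hu : AEMeasurable u volume) (a b : ℝ) :
    Measurable fun x => ∫⁻ t in Set.Icc a b, u (x + t) := by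
  obtain ⟨u', hm, he⟩ := hu
  have : (fun x => ∫⁻ t in Set.Icc a b, u (x + t)) = fun x => ∫⁻ t in Set.Icc a b, u' (x + t) := by
    funext x
    rw [lintegral_Icc_add, lintegral_Icc_add]
    exact lintegral_congr_ae (ae_restrict_of_ae he)
  rw [this]
  exact Measurable.lintegral_prod_right' (f := fun z : ℝ × ℝ => u' (z.1 + z.2))
    (hm.comp (measurable_fst.add measurable_snd))

theorem measurable_avg {u : ℝ → ℝ≥0∞} (hu : AEMeasurable u volume) (v : ℝ) :
    Measurable (avg v u) := (measurable_window hu _ _).const_mul _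

/-- With K = ⌈v/2π⌉, the window is covered by 2K whole periods, and the window of half-length 2π
consists of two. Rounding up costs at most a factor 2, since K·2π ≤ 2v. -/
theorem avg_le_two_mul_avg_period {u : ℝ → ℝ≥0∞} (hu : Function.Periodic u (2 * pi)) {v : ℝ}
    (hv : 2 * pi ≤ v) (x : ℝ) : avg v u x ≤ 2 * avg (2 * pi) u x := by
  have hp := pi_pos
  set I := ∫⁻ t in Set.Icc (-(2 * pi)) (2 * pi), u (x + t) with hI
  set w : ℝ → ℝ≥0∞ := fun t => u (x + t) with hw
  have hwp : Function.Periodic w (2 * pi) := fun t => by simp only [hw, ← add_assoc]; exact hu _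
  set K := ⌈v / (2 * pi)⌉₊ with hK
  have hK1 : v ≤ K * (2 * pi) := by
    have := Nat.le_ceil (v / (2 * pi))
    rwa [div_le_iff₀ (by positivity)] at this
  have hK2 : (K : ℝ) * (2 * pi) ≤ 2 * v := by
    have h1 := (Nat.ceil_lt_add_one (a := v / (2 * pi)) (div_nonneg (by linarith) (by positivity))).le
    have h2 : 1 ≤ v / (2 * pi) := by rwa [le_div_iff₀ (by positivity), one_mul]
    have h3 : (K : ℝ) ≤ 2 * (v / (2 * pi)) := by rw [hK]; linarith
    calc (K : ℝ) * (2 * pi) ≤ 2 * (v / (2 * pi)) * (2 * pi) := by gcongr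
      _ = 2 * v := by field_simp
  have cell : ∀ n : ℤ, ∫⁻ t in Set.Icc (n * (2 * pi)) ((n + 1) * (2 * pi)), w t =
      ∫⁻ t in Set.Icc 0 (2 * pi), w t := by
    intro n
    have := lintegral_Icc_add w 0 (2 * pi) (n * (2 * pi))
    rw [add_zero] at this
    rw [add_mul, one_mul, ← this]
    refine lintegral_congr fun t => ?_
    rw [add_comm]
    exact hwp.int_mul n t
  have e1 : I = 2 * ∫⁻ t in Set.Icc 0 (2 * pi), w t := by
    rw [hI, lintegral_Icc_split w (b := 0) (by linarith) (by linarith), two_mul (lintegral _ _)]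
    congr 1
    have := cell (-1)
    push_cast at this
    rw [← this]; congr 3 <;> ring
  have e2 : ∫⁻ t in Set.Icc (-v) v, w t ≤ K * I := by
    calc ∫⁻ t in Set.Icc (-v) v, w t
        ≤ ∫⁻ t in Set.Icc (-(K * (2 * pi))) (-(K * (2 * pi)) + (2 * K : ℕ) * (2 * pi)), w t := by
          refine lintegral_mono_set (Set.Icc_subset_Icc ?_ ?_)
          · linarith
          · push_cast; linarith
      _ = ∑ j ∈ Finset.range (2 * K), ∫⁻ t in Set.Icc 0 (2 * pi), w t := by
          rw [lintegral_Icc_sum w _ _ (by positivity)]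
          refine Finset.sum_congr rfl fun j _ => ?_
          rw [← cell (j - K)]
          congr 3 <;> push_cast <;> ring
      _ = K * I := by
          rw [Finset.sum_const, Finset.card_range, e1, nsmul_eq_mul]; push_cast; ring
  have hvpos : 0 < v := by linarith
  calc avg v u x ≤ (ENNReal.ofReal v)⁻¹ * (K * I) := by unfold avg; gcongr
    _ ≤ 2 * ((ENNReal.ofReal (2 * pi))⁻¹ * I) := by
        rw [← mul_assoc, ← mul_assoc]
        refine mul_le_mul_left ?_ I
        rw [← ENNReal.ofReal_inv_of_pos hvpos, ← ENNReal.ofReal_inv_of_pos (by positivity),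
          ← ENNReal.ofReal_natCast K, ← ENNReal.ofReal_ofNat 2, ← ENNReal.ofReal_mul (by positivity),
          ← ENNReal.ofReal_mul (by positivity)]
        refine ENNReal.ofReal_le_ofReal ?_
        rw [inv_mul_le_iff₀ hvpos]
        have : (K : ℝ) ≤ 2 * v / (2 * pi) := by rwa [le_div_iff₀ (by positivity)]
        calc (K : ℝ) ≤ 2 * v / (2 * pi) := this
          _ = v * (2 * (2 * pi)⁻¹) := by ring
    _ = _ := by unfold avg; rfl

/-! ### Weighted boundedness of averages over short windows. -/

theorem add_three_rpow_le (x y z : ℝ≥0∞) {q : ℝ} (hq : 0 ≤ q) :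
    (x + y + z) ^ q ≤ 3 ^ q * (x ^ q + y ^ q + z ^ q) := by
  have h : x + y + z ≤ 3 * max (max x y) z := by
    have h1 : x ≤ max (max x y) z := (le_max_left _ _).trans (le_max_left _ _)
    have h2 : y ≤ max (max x y) z := (le_max_right _ _).trans (le_max_left _ _)
    have h3 : z ≤ max (max x y) z := le_max_right _ _
    calc x + y + z ≤ max (max x y) z + max (max x y) z + max (max x y) z := by gcongr
      _ = 3 * max (max x y) z := by ring
  calc (x + y + z) ^ q ≤ (3 * max (max x y) z) ^ q := by gcongr
    _ = 3 ^ q * (max (max x y) z) ^ q := ENNReal.mul_rpow_of_nonneg _ _ hq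
    _ ≤ _ := by
      gcongr
      rcases max_choice (max x y) z with h | h
      · rcases max_choice x y with h' | h'
        · rw [h, h', add_assoc]; exact le_self_add
        · rw [h, h', add_comm (x ^ q), add_assoc]; exact le_self_add
      · rw [h]; exact le_add_self

/-- Reverse Jensen inequality on the subintervals of `𝕋`. -/
def MeanBound (q : ℝ) (γ : ℝ → ℝ≥0∞) (B : ℝ≥0) : Prop :=
  ∀ a b : ℝ, -pi ≤ a → a < b → b ≤ pi → ∀ u : ℝ → ℝ≥0∞, AEMeasurable u volume →
    (∫⁻ t in Set.Icc a b, u t) ^ q * mass γ (Set.Icc a b)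
      ≤ B * ENNReal.ofReal (b - a) ^ q * ∫⁻ t in Set.Icc a b, u t ^ q * γ t

/-- Adjacent intervals of equal length on the circle have comparable masses. -/
def NeighbourBound (γ : ℝ → ℝ≥0∞) (D : ℝ≥0) : Prop :=
  ∀ b b' h : ℝ, 0 < h → -pi ≤ b - h → b ≤ pi → -pi ≤ b' → b' + h ≤ pi →
    (b' = b ∨ b' = b - 2 * pi) →
    mass γ (Set.Icc b' (b' + h)) ≤ D * mass γ (Set.Icc (b - h) b) ∧
    mass γ (Set.Icc (b - h) b) ≤ D * mass γ (Set.Icc b' (b' + h))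

theorem periodic_emod {w : ℤ → ℝ≥0∞} {M : ℕ} (hw : Function.Periodic w M) (j : ℤ) :
    w (j % M) = w j := by
  rw [Int.emod_def, mul_comm]
  exact hw.sub_int_mul_eq (j / M)

/-- Both sums differ from the sum of M + 1 consecutive terms by the same end term. Cancelling it in
`ℝ≥0∞` requires it to be finite; if it is infinite, so are both sums. -/
theorem sum_range_succ_of_periodic {w : ℤ → ℝ≥0∞} {M : ℕ} (hw : Function.Periodic w M) :
    ∑ j ∈ Finset.range M, w (j + 1) = ∑ j ∈ Finset.range M, w j := by
  have h1 := Finset.sum_range_succ (fun j : ℕ => w j) M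
  have h2 := Finset.sum_range_succ' (fun j : ℕ => w j) M
  rw [h1] at h2
  rcases M with _ | M
  · simp
  · have h0 : w ((M + 1 : ℕ) : ℤ) = w ((0 : ℕ) : ℤ) := by
      have := hw 0
      rwa [zero_add] at this
    rw [h0] at h2
    by_cases ht : w ((0 : ℕ) : ℤ) = ∞
    · have hl : ∑ j ∈ Finset.range (M + 1), w j = ∞ :=
        ENNReal.sum_eq_top.2 ⟨0, by simp, by simpa using ht⟩
      have hr : ∑ j ∈ Finset.range (M + 1), w (j + 1) = ∞ :=
        ENNReal.sum_eq_top.2 ⟨M, by simp, by rw [← ht, ← h0]; push_cast; rfl⟩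
      rw [hl, hr]
    · have := (ENNReal.add_left_inj ht).1 h2
      rw [this]
      refine Finset.sum_congr rfl fun j _ => ?_
      push_cast; rfl

/-- Let a, m, w be the cell integrals of u, γ and u^q γ. For x in cell j the window lies in cells j
- 1, j, j + 1, so avg^q is at most (3/v)^q times the sum of the three a_i^q. Then a_i^q m_j ≤ D
a_i^q m_i ≤ D B h^q w_i, and 3h/v ≤ 6. Each cell is used three times in the sum around the circle.
-/
theorem lintegral_avg_rpow_le_of_le {q : ℝ} (hq : 1 ≤ q) {γ : ℝ → ℝ≥0∞}
    (hγ : AEMeasurable γ volume) (hper : Function.Periodic γ (2 * pi)) {B D : ℝ≥0} (hD1 : 1 ≤ D)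
    (hB : MeanBound q γ B) (hD : NeighbourBound γ D) {v : ℝ} (hv : 0 < v) (hv2 : v ≤ 2 * pi)
    {u : ℝ → ℝ≥0∞} (hu : Function.Periodic u (2 * pi)) (hum : AEMeasurable u volume) :
    ∫⁻ x in Set.Icc (-pi) pi, avg v u x ^ q * γ x ≤
      (3 * 6 ^ q * D * B) * ∫⁻ x in Set.Icc (-pi) pi, u x ^ q * γ x := by
  have hp := pi_pos
  have hq0 : 0 ≤ q := by linarith
  -- The floor makes h = 2π/M at least v, so that a window meets only adjacent cells, and at most
  -- 2v, so that h/v stays bounded.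
  set M := ⌊2 * pi / v⌋₊ with hM
  have hx1 : 1 ≤ 2 * pi / v := by rwa [le_div_iff₀ hv, one_mul]
  have hM1 : 1 ≤ M := Nat.le_floor (by simpa using hx1)
  have hM1' : (1 : ℝ) ≤ M := by exact_mod_cast hM1
  have hM0 : (0 : ℝ) < M := by linarith
  set h := 2 * pi / M with hh
  have hh0 : 0 < h := by positivity
  have hMh : M * h = 2 * pi := by rw [hh]; field_simp
  have hvh : v ≤ h := by
    have : (M : ℝ) ≤ 2 * pi / v := Nat.floor_le (by positivity)
    rw [le_div_iff₀ hv] at this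
    rw [hh, le_div_iff₀ hM0]; linarith
  have hh2 : h ≤ 2 * v := by
    have := (Nat.lt_floor_add_one (2 * pi / v)).le
    rw [← hM, div_le_iff₀ hv] at this
    rw [hh, div_le_iff₀ hM0]
    nlinarith
  let cell : ℤ → Set ℝ := fun j => Set.Icc (-pi + j * h) (-pi + (j + 1) * h)
  have cell_per : ∀ w : ℝ → ℝ≥0∞, Function.Periodic w (2 * pi) →
      Function.Periodic (fun j => ∫⁻ t in cell j, w t) (M : ℤ) := by
    intro w hw j
    have := lintegral_Icc_add_period hw (-pi + j * h) (-pi + (j + 1) * h)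
    simp only [cell]
    rw [← this]
    congr 3 <;> push_cast <;> linear_combination hMh
  set a : ℤ → ℝ≥0∞ := fun j => ∫⁻ t in cell j, u t with ha
  set m : ℤ → ℝ≥0∞ := fun j => ∫⁻ t in cell j, γ t with hm
  set w : ℤ → ℝ≥0∞ := fun j => ∫⁻ t in cell j, u t ^ q * γ t with hw
  have pa : Function.Periodic a M := cell_per u hu
  have pm : Function.Periodic m M := cell_per γ hper
  have pw : Function.Periodic w M := cell_per _ fun x => by simp only [hu x, hper x]
  have mod_bounds : ∀ j : ℤ, ∃ r : ℕ, r < M ∧ ((j % (M : ℤ)) = r) := by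
    intro j
    have h1 := Int.emod_nonneg j (b := M) (by omega)
    have h2 := Int.emod_lt_of_pos j (b := M) (by omega)
    exact ⟨(j % (M : ℤ)).toNat, by omega, by omega⟩
  have cell_lo : ∀ r : ℕ, -pi ≤ -pi + (r : ℝ) * h := fun r => by
    have : 0 ≤ (r : ℝ) * h := by positivity
    linarith
  have cell_hi : ∀ r : ℕ, r < M → -pi + ((r : ℝ) + 1) * h ≤ pi := fun r hr => by
    have : ((r : ℝ) + 1) ≤ M := by exact_mod_cast hr
    have : ((r : ℝ) + 1) * h ≤ M * h := by gcongr
    linarith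
  have hBj : ∀ j : ℤ, a j ^ q * m j ≤ B * ENNReal.ofReal h ^ q * w j := by
    intro j
    obtain ⟨r, hr, hj⟩ := mod_bounds j
    rw [← periodic_emod pa j, ← periodic_emod pm j, ← periodic_emod pw j, hj]
    have := hB _ _ (cell_lo r) (by linarith) (cell_hi r hr) u hum
    rwa [show -pi + ((r : ℝ) + 1) * h - (-pi + r * h) = h by ring] at this
  have hDj : ∀ j : ℤ, m (j + 1) ≤ D * m j ∧ m j ≤ D * m (j + 1) := by
    intro j
    obtain ⟨r, hr, hj⟩ := mod_bounds j
    have e0 : m j = m r := by rw [← periodic_emod pm j, hj]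
    have e1 : m (j + 1) = m (r + 1) := by
      rw [← periodic_emod pm (j + 1), ← periodic_emod pm ((r : ℤ) + 1), ← hj]; simp
    have er : m r = mass γ (Set.Icc (-pi + ((r : ℝ) + 1) * h - h) (-pi + ((r : ℝ) + 1) * h)) := by
      simp only [hm, cell, mass]; congr 3; push_cast; ring
    rw [e0, e1, er]
    rcases Nat.lt_or_ge (r + 1) M with hlt | hge
    · have e2 : m (r + 1) = mass γ (Set.Icc (-pi + ((r : ℝ) + 1) * h)
          (-pi + ((r : ℝ) + 1) * h + h)) := by
        simp only [hm, cell, mass]; congr 3 <;> push_cast <;> ring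
      rw [e2]
      have hhi := cell_hi (r + 1) hlt
      have hlo := cell_lo (r + 1)
      push_cast at hhi hlo
      exact hD _ _ h hh0 (by linarith [cell_lo r]) (cell_hi r hr) hlo (by linarith) (Or.inl rfl)
    -- The last cell is adjacent to the first across the point ±π; this is the case b' = b - 2π of
    -- `NeighbourBound`.
    · have hrM : (r : ℤ) + 1 = 0 + M := by omega
      have e2 : m (r + 1) = mass γ (Set.Icc (-pi) (-pi + h)) := by
        rw [hrM, pm]
        simp only [hm, cell, mass]; congr 3 <;> push_cast <;> ring
      have hrM' : (r : ℝ) + 1 = M := by exact_mod_cast (by omega : r + 1 = M)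
      have hb : -pi + ((r : ℝ) + 1) * h = pi := by rw [hrM']; linarith
      rw [e2]
      refine hD _ _ h hh0 (by linarith [cell_lo r]) (cell_hi r hr) le_rfl ?_ (Or.inr ?_)
      · nlinarith
      · linarith
  have hterm : ∀ i j : ℤ, m j ≤ D * m i → a i ^ q * m j ≤ D * B * ENNReal.ofReal h ^ q * w i := by
    intro i j hij
    calc a i ^ q * m j ≤ a i ^ q * (D * m i) := by gcongr
      _ = D * (a i ^ q * m i) := by ring
      _ ≤ D * (B * ENNReal.ofReal h ^ q * w i) := mul_le_mul_right (hBj i) _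
      _ = _ := by ring
  have hself : ∀ j, m j ≤ D * m j := fun j => by
    calc m j = 1 * m j := (one_mul _).symm
      _ ≤ D * m j := by gcongr; exact_mod_cast hD1
  have hcell : ∀ j : ℤ, ∫⁻ x in cell j, avg v u x ^ q * γ x ≤
      6 ^ q * D * B * (w (j - 1) + w j + w (j + 1)) := by
    intro j
    set A := (ENNReal.ofReal v)⁻¹ ^ q * (3 ^ q * (a (j - 1) ^ q + a j ^ q + a (j + 1) ^ q)) with hA
    have hpt : ∀ x ∈ cell j, avg v u x ^ q * γ x ≤ A * γ x := by
      intro x hx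
      gcongr
      unfold avg
      rw [ENNReal.mul_rpow_of_nonneg _ _ hq0]
      rw [hA]
      gcongr
      refine le_trans ?_ (add_three_rpow_le _ _ _ hq0)
      gcongr
      rw [lintegral_Icc_add]
      have e : a (j - 1) + a j + a (j + 1) =
          ∫⁻ t in Set.Icc (-pi + ((j : ℝ) - 1) * h) (-pi + ((j : ℝ) + 2) * h), u t := by
        rw [lintegral_Icc_split u (b := -pi + j * h) (by nlinarith) (by nlinarith),
          lintegral_Icc_split u (a := -pi + j * h) (b := -pi + (j + 1) * h) (by nlinarith)
          (by nlinarith), ← add_assoc]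
        simp only [ha, cell]
        push_cast
        congr 4 <;> ring_nf
      rw [e]
      refine lintegral_mono_set (Set.Icc_subset_Icc ?_ ?_)
      · linarith [hx.1]
      · linarith [hx.2]
    calc ∫⁻ x in cell j, avg v u x ^ q * γ x ≤ ∫⁻ x in cell j, A * γ x :=
          setLIntegral_mono' measurableSet_Icc hpt
      _ ≤ A * m j := by
          rw [lintegral_const_mul'' _ hγ.restrict]
      _ = (ENNReal.ofReal v)⁻¹ ^ q * 3 ^ q * (a (j - 1) ^ q * m j + a j ^ q * m j
            + a (j + 1) ^ q * m j) := by rw [hA]; ring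
      _ ≤ (ENNReal.ofReal v)⁻¹ ^ q * 3 ^ q * (D * B * ENNReal.ofReal h ^ q * w (j - 1)
            + D * B * ENNReal.ofReal h ^ q * w j + D * B * ENNReal.ofReal h ^ q * w (j + 1)) := by
          refine mul_le_mul_right (add_le_add (add_le_add ?_ ?_) ?_) _
          · refine hterm _ _ ?_
            have := (hDj (j - 1)).1
            rwa [sub_add_cancel] at this
          · exact hterm _ _ (hself j)
          · exact hterm _ _ (hDj j).2
      _ = ((ENNReal.ofReal v)⁻¹ ^ q * 3 ^ q * ENNReal.ofReal h ^ q) * (D * B) *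
            (w (j - 1) + w j + w (j + 1)) := by ring
      _ ≤ 6 ^ q * (D * B) * (w (j - 1) + w j + w (j + 1)) := by
          gcongr
          rw [← ENNReal.mul_rpow_of_nonneg _ _ hq0, ← ENNReal.mul_rpow_of_nonneg _ _ hq0]
          gcongr
          rw [← ENNReal.ofReal_inv_of_pos hv, ← ENNReal.ofReal_ofNat 3, ← ENNReal.ofReal_ofNat 6,
            ← ENNReal.ofReal_mul (by positivity), ← ENNReal.ofReal_mul (by positivity)]
          refine ENNReal.ofReal_le_ofReal ?_
          rw [mul_assoc, inv_mul_le_iff₀ hv]; linarith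
      _ = _ := by ring
  have hpi : pi = -pi + M * h := by linarith
  have hsplit : ∀ g : ℝ → ℝ≥0∞, ∫⁻ x in Set.Icc (-pi) pi, g x =
      ∑ j ∈ Finset.range M, ∫⁻ x in cell j, g x := by
    intro g
    have := lintegral_Icc_sum g (-pi) h hh0.le M
    rw [← hpi] at this
    rw [this]
    simp only [cell]
    push_cast; rfl
  rw [hsplit, hsplit]
  calc _ ≤ ∑ j ∈ Finset.range M, 6 ^ q * D * B * (w ((j : ℤ) - 1) + w j + w ((j : ℤ) + 1)) :=
        Finset.sum_le_sum fun j _ => hcell j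
    _ = 3 * 6 ^ q * D * B * ∑ j ∈ Finset.range M, w j := by
        rw [← Finset.mul_sum, Finset.sum_add_distrib, Finset.sum_add_distrib,
          sum_range_succ_of_periodic pw]
        have := sum_range_succ_of_periodic (w := fun j => w (j - 1)) (M := M)
          (fun j => by simp only; rw [show j + (M : ℤ) - 1 = j - 1 + M by ring]; exact pw _)
        simp only [add_sub_cancel_right] at this
        rw [← this]; ring
    _ = _ := rfl

/-! ### The weight classes satisfy the hypotheses on averages. -/

theorem Icc_subset_torus {a b : ℝ} (ha : -pi ≤ a) (hb : b ≤ pi) :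
    Set.Icc a b ⊆ Set.Icc (-pi) pi := Set.Icc_subset_Icc ha hb

theorem mass_add_period {γ : ℝ → ℝ≥0∞} (hγ : Function.Periodic γ (2 * pi)) (a b : ℝ) :
    mass γ (Set.Icc (a + 2 * pi) (b + 2 * pi)) = mass γ (Set.Icc a b) :=
  lintegral_Icc_add_period hγ a b

theorem mass_mono (γ : ℝ → ℝ≥0∞) {A B : Set ℝ} (h : A ⊆ B) : mass γ A ≤ mass γ B :=
  lintegral_mono_set h

/-- Doubling an interval of length h extends it only by h/2 on each side. An interval is therefore
compared with its half touching the common endpoint (two doublings, through three quarters of its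
length), and that half is contained in the double of the neighbour. This gives D = C³. -/
theorem IsDoubling.neighbourBound {γ : ℝ → ℝ≥0∞} (h : IsDoubling γ) :
    ∃ D : ℝ≥0, NeighbourBound γ D := by
  obtain ⟨C, hC⟩ := h.doubling
  have hper := h.isWeight.periodic
  have hp := pi_pos
  have dbl : ∀ a b c d : ℝ, -pi ≤ a → a < b → b ≤ pi → (a + b) / 2 - (b - a) ≤ c →
      d ≤ (a + b) / 2 + (b - a) → mass γ (Set.Icc c d) ≤ C * mass γ (Set.Icc a b) :=
    fun a b c d h1 h2 h3 h4 h5 => (mass_mono γ (Set.Icc_subset_Icc h4 h5)).trans (hC a b h1 h2 h3)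
  have right : ∀ b h : ℝ, 0 < h → -pi ≤ b → b + h ≤ pi →
      mass γ (Set.Icc b (b + h)) ≤ C ^ 2 * mass γ (Set.Icc b (b + h / 2)) := by
    intro b h h0 hb hbh
    have e1 := dbl b (b + 3 * h / 4) b (b + h) hb (by linarith) (by linarith) (by linarith)
      (by linarith)
    have e2 := dbl b (b + h / 2) b (b + 3 * h / 4) hb (by linarith) (by linarith) (by linarith)
      (by linarith)
    calc _ ≤ _ := e1
      _ ≤ C * (C * mass γ (Set.Icc b (b + h / 2))) := by gcongr
      _ = _ := by ring
  have left : ∀ b h : ℝ, 0 < h → -pi ≤ b - h → b ≤ pi →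
      mass γ (Set.Icc (b - h) b) ≤ C ^ 2 * mass γ (Set.Icc (b - h / 2) b) := by
    intro b h h0 hb hbh
    have e1 := dbl (b - 3 * h / 4) b (b - h) b (by linarith) (by linarith) hbh (by linarith)
      (by linarith)
    have e2 := dbl (b - h / 2) b (b - 3 * h / 4) b (by linarith) (by linarith) hbh (by linarith)
      (by linarith)
    calc _ ≤ _ := e1
      _ ≤ C * (C * mass γ (Set.Icc (b - h / 2) b)) := by gcongr
      _ = _ := by ring
  have shift : ∀ b b' s t : ℝ, (b' = b ∨ b' = b - 2 * pi) →
      mass γ (Set.Icc (b' + s) (b' + t)) = mass γ (Set.Icc (b + s) (b + t)) := by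
    rintro b b' s t (rfl | rfl)
    · rfl
    · rw [← mass_add_period hper]; congr 2 <;> ring
  refine ⟨C ^ 3, fun b b' h h0 hb1 hb2 hb3 hb4 hbb => ⟨?_, ?_⟩⟩
  · have e := dbl (b - h) b b (b + h / 2) hb1 (by linarith) hb2 (by linarith) (by linarith)
    have sh := shift b b' 0 (h / 2) hbb
    simp only [add_zero] at sh
    calc _ ≤ _ := right b' h h0 hb3 hb4
      _ = C ^ 2 * mass γ (Set.Icc b (b + h / 2)) := by rw [sh]
      _ ≤ C ^ 2 * (C * mass γ (Set.Icc (b - h) b)) := by gcongr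
      _ = _ := by push_cast; ring
  · have e := dbl b' (b' + h) (b' - h / 2) b' hb3 (by linarith) hb4 (by linarith) (by linarith)
    have sh := shift b b' (-(h / 2)) 0 hbb
    simp only [add_zero, ← sub_eq_add_neg] at sh
    calc _ ≤ _ := left b h h0 hb1 hb2
      _ = C ^ 2 * mass γ (Set.Icc (b' - h / 2) b') := by rw [sh]
      _ ≤ C ^ 2 * (C * mass γ (Set.Icc b' (b' + h))) := by gcongr
      _ = _ := by push_cast; ring

theorem mass_Icc_le_of_meanConst {γ : ℝ → ℝ≥0∞} {a b : ℝ} (ha : -pi ≤ a) (hab : a < b)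
    (hb : b ≤ pi) : mass γ (Set.Icc a b) ≤ meanConst γ * ENNReal.ofReal (b - a) := by
  have h : mass γ (Set.Icc a b) / ENNReal.ofReal (b - a) ≤ meanConst γ :=
    le_iSup_of_le a (le_iSup_of_le b (le_iSup_of_le ⟨ha, hab, hb⟩ le_rfl))
  rwa [ENNReal.div_le_iff (by simpa using hab) ENNReal.ofReal_ne_top] at h

/-- The mass of an interval lies between c|J| and K|J|, so any two intervals of equal length
compare, adjacent or not. -/
theorem ClassS1.neighbourBound {γ : ℝ → ℝ≥0∞} (h : ClassS1 γ) :
    ∃ D : ℝ≥0, NeighbourBound γ D := by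
  obtain ⟨-, hK, c, hc, hcγ⟩ := h
  lift meanConst γ to ℝ≥0 using hK.ne with K hKK
  have key : ∀ a b a' b' : ℝ, -pi ≤ a → a < b → b ≤ pi → -pi ≤ a' → b' ≤ pi → b' - a' = b - a →
      mass γ (Set.Icc a b) ≤ (K / c : ℝ≥0) * mass γ (Set.Icc a' b') := by
    intro a b a' b' h1 h2 h3 h4 h5 h6
    have e1 := mass_Icc_le_of_meanConst (γ := γ) h1 h2 h3
    have e2 : (c : ℝ≥0∞) * ENNReal.ofReal (b - a) ≤ mass γ (Set.Icc a' b') := by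
      calc (c : ℝ≥0∞) * ENNReal.ofReal (b - a) = ∫⁻ _ in Set.Icc a' b', (c : ℝ≥0∞) := by
            rw [setLIntegral_const, Real.volume_Icc, h6]
        _ ≤ _ := lintegral_mono_ae (ae_restrict_of_ae_restrict_of_subset
              (Icc_subset_torus h4 h5) hcγ)
    rw [← hKK] at e1
    calc _ ≤ _ := e1
      _ = (K / c : ℝ≥0) * (c * ENNReal.ofReal (b - a)) := by
        rw [← mul_assoc, ← ENNReal.coe_mul, div_mul_cancel₀ _ hc.ne']
      _ ≤ _ := by gcongr
  refine ⟨K / c, fun b b' h h0 hb1 hb2 hb3 hb4 _ => ⟨?_, ?_⟩⟩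
  · exact key _ _ _ _ hb3 (by linarith) hb4 hb1 hb2 (by ring)
  · exact key _ _ _ _ hb1 (by linarith) hb2 hb3 hb4 (by ring)

theorem ClassS1.meanBound {γ : ℝ → ℝ≥0∞} (h : ClassS1 γ) : ∃ B : ℝ≥0, MeanBound 1 γ B := by
  obtain ⟨-, hK, c, hc, hcγ⟩ := h
  lift meanConst γ to ℝ≥0 using hK.ne with K hKK
  refine ⟨K / c, fun a b ha hab hb u _ => ?_⟩
  simp only [ENNReal.rpow_one]
  have e1 := mass_Icc_le_of_meanConst (γ := γ) ha hab hb
  rw [← hKK] at e1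
  have e2 : (c : ℝ≥0∞) * ∫⁻ t in Set.Icc a b, u t ≤ ∫⁻ t in Set.Icc a b, u t * γ t := by
    rw [← lintegral_const_mul' _ _ ENNReal.coe_ne_top]
    refine lintegral_mono_ae ?_
    filter_upwards [ae_restrict_of_ae_restrict_of_subset (Icc_subset_torus ha hb) hcγ] with x hx
    rw [mul_comm]; gcongr
  calc _ ≤ (∫⁻ t in Set.Icc a b, u t) * (K * ENNReal.ofReal (b - a)) := by gcongr
    _ = (K / c : ℝ≥0) * ENNReal.ofReal (b - a) * (c * ∫⁻ t in Set.Icc a b, u t) := by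
      have : (K : ℝ≥0∞) = (K / c : ℝ≥0) * c := by
        rw [← ENNReal.coe_mul, div_mul_cancel₀ _ hc.ne']
      rw [this]; ring
    _ ≤ _ := by gcongr

theorem IsWeight.ae_pos {γ : ℝ → ℝ≥0∞} (h : IsWeight γ) : ∀ᵐ x, 0 < γ x :=
  ae_of_periodic (fun x => by rw [h.periodic x]) h.pos

/-- Hölder's inequality applied to u = (u γ^{1/q}) · γ^{-1/q}; the dual factor is exactly the one
controlled by the Muckenhoupt constant. -/
theorem MuckenhouptAp.meanBound {q : ℝ} (hq : 1 < q) {γ : ℝ → ℝ≥0∞} (h : MuckenhouptAp q γ) :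
    ∃ B : ℝ≥0, MeanBound q γ B := by
  obtain ⟨hd, hA⟩ := h
  set A := muckenhouptConst q γ with hAdef
  lift A to ℝ≥0 using hA.ne with K hKK
  refine ⟨K, fun a b ha hab hb u hu => ?_⟩
  have hconj : q.HolderConjugate (q / (q - 1)) := Real.HolderConjugate.conjExponent hq
  have hq1 : 0 < q - 1 := by linarith
  have hq0 : 0 < q := by linarith
  have hγm := hd.isWeight.aemeasurable
  -- The powers of γ cancel in `ℝ≥0∞` only where γ is neither 0 nor ∞, which integrability and
  -- positivity guarantee a.e.
  have hfin : ∀ᵐ x ∂volume.restrict (Set.Icc a b), γ x < ∞ :=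
    ae_restrict_of_ae_restrict_of_subset (Icc_subset_torus ha hb)
      (ae_lt_top' hγm.restrict hd.integrable.ne)
  set σ := ∫⁻ t in Set.Icc a b, γ t ^ (-1 / (q - 1)) with hσ
  set L := ENNReal.ofReal (b - a) with hL
  have hL0 : L ≠ 0 := by simpa [hL] using hab
  have hLt : L ≠ ∞ := ENNReal.ofReal_ne_top
  have hmuck : mass γ (Set.Icc a b) * σ ^ (q - 1) ≤ K * L ^ q := by
    have h1 : (mass γ (Set.Icc a b) / L) * (σ / L) ^ (q - 1) ≤ K := by
      rw [hKK]
      exact le_iSup_of_le a (le_iSup_of_le b (le_iSup_of_le ⟨ha, hab, hb⟩ le_rfl))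
    rw [ENNReal.div_rpow_of_nonneg _ _ hq1.le, div_eq_mul_inv, div_eq_mul_inv] at h1
    have hLq : L ^ q = L * L ^ (q - 1) := by
      nth_rw 2 [← ENNReal.rpow_one L]
      rw [← ENNReal.rpow_add _ _ hL0 hLt, add_sub_cancel]
    have hLc : L⁻¹ * L = 1 := ENNReal.inv_mul_cancel hL0 hLt
    have hLc' : (L ^ (q - 1))⁻¹ * L ^ (q - 1) = 1 :=
      ENNReal.inv_mul_cancel (ENNReal.rpow_pos (pos_iff_ne_zero.2 hL0) hLt).ne'
        (ENNReal.rpow_ne_top_of_nonneg hq1.le hLt)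
    calc mass γ (Set.Icc a b) * σ ^ (q - 1)
        = mass γ (Set.Icc a b) * σ ^ (q - 1) * (L⁻¹ * L) *
            ((L ^ (q - 1))⁻¹ * L ^ (q - 1)) := by rw [hLc, hLc', mul_one, mul_one]
      _ = mass γ (Set.Icc a b) * L⁻¹ * (σ ^ (q - 1) * (L ^ (q - 1))⁻¹) * L ^ q := by rw [hLq]; ring
      _ ≤ K * L ^ q := by gcongr
  have hold : (∫⁻ t in Set.Icc a b, u t) ^ q ≤
      (∫⁻ t in Set.Icc a b, u t ^ q * γ t) * σ ^ (q - 1) := by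
    have hmain := ENNReal.lintegral_mul_le_Lp_mul_Lq (volume.restrict (Set.Icc a b)) hconj
      (f := fun t => u t * γ t ^ (1 / q)) (g := fun t => γ t ^ (-1 / q))
      (hu.restrict.mul (hγm.restrict.pow_const _)) (hγm.restrict.pow_const _)
    have e0 : ∫⁻ t in Set.Icc a b, u t =
        ∫⁻ t in Set.Icc a b, ((fun t => u t * γ t ^ (1 / q)) * fun t => γ t ^ (-1 / q)) t := by
      refine lintegral_congr_ae ?_
      filter_upwards [hfin, ae_restrict_of_ae hd.isWeight.ae_pos] with x h1 h2
      simp only [Pi.mul_apply]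
      rw [mul_assoc, ← ENNReal.rpow_add _ _ h2.ne' h1.ne]
      rw [show 1 / q + -1 / q = 0 by ring, ENNReal.rpow_zero, mul_one]
    have e1 : ∀ t, (u t * γ t ^ (1 / q)) ^ q = u t ^ q * γ t := fun t => by
      rw [ENNReal.mul_rpow_of_nonneg _ _ hq0.le, ← ENNReal.rpow_mul,
        show 1 / q * q = 1 by field_simp, ENNReal.rpow_one]
    have e2 : ∀ t, (γ t ^ (-1 / q)) ^ (q / (q - 1)) = γ t ^ (-1 / (q - 1)) := fun t => by
      rw [← ENNReal.rpow_mul]; congr 1; field_simp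
    simp only [e1, e2] at hmain
    rw [e0]
    calc _ ≤ _ := ENNReal.rpow_le_rpow hmain hq0.le
      _ = _ := by
        rw [ENNReal.mul_rpow_of_nonneg _ _ hq0.le, ← ENNReal.rpow_mul, ← ENNReal.rpow_mul,
          show 1 / q * q = 1 by field_simp, ENNReal.rpow_one,
          show 1 / (q / (q - 1)) * q = q - 1 by field_simp]
  calc _ ≤ ((∫⁻ t in Set.Icc a b, u t ^ q * γ t) * σ ^ (q - 1)) * mass γ (Set.Icc a b) := by
        gcongr
    _ = (mass γ (Set.Icc a b) * σ ^ (q - 1)) * ∫⁻ t in Set.Icc a b, u t ^ q * γ t := by ring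
    _ ≤ _ := by gcongr

/-- The properties of the pair `(p, γ)` used in the approximation theorems: averages are uniformly
bounded in `L_{p,γ}`, constants belong to `L_{p,γ}`, and Lebesgue measure on `𝕋` is absolutely
continuous with respect to `γ(x) dx`. -/
structure Admissible (p : ℝ≥0∞) (γ : ℝ → ℝ≥0∞) (C : ℝ≥0) : Prop where
  one_le : 1 ≤ p
  memLp_one : MemLp (fun _ : ℝ => (1 : ℝ)) p (weightedMeasure γ)
  ac : volume.restrict (Set.Icc (-pi) pi) ≪ weightedMeasure γ
  avg_le : ∀ v : ℝ, 0 < v → ∀ u : ℝ → ℝ≥0∞, Function.Periodic u (2 * pi) →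
    AEMeasurable u volume → eLpNorm (avg v u) p (weightedMeasure γ) ≤
      C * eLpNorm u p (weightedMeasure γ)

theorem IsWeight.absolutelyContinuous {γ : ℝ → ℝ≥0∞} (h : IsWeight γ) :
    volume.restrict (Set.Icc (-pi) pi) ≪ weightedMeasure γ :=
  withDensity_absolutelyContinuous' h.aemeasurable.restrict (h.pos.mono fun _ hx => hx.ne')

theorem eLpNorm_weightedMeasure {p : ℝ≥0∞} (hp0 : p ≠ 0) (hp : p ≠ ∞) {γ : ℝ → ℝ≥0∞}
    (hγ : AEMeasurable γ volume) {u : ℝ → ℝ≥0∞} (hu : AEMeasurable u volume) :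
    eLpNorm u p (weightedMeasure γ) =
      (∫⁻ x in Set.Icc (-pi) pi, u x ^ p.toReal * γ x) ^ (1 / p.toReal) := by
  rw [eLpNorm_eq_lintegral_rpow_enorm_toReal hp0 hp, weightedMeasure,
    lintegral_withDensity_eq_lintegral_mul₀ hγ.restrict (hu.restrict.enorm.pow_const _)]
  simp [mul_comm]

theorem NeighbourBound.mono {γ : ℝ → ℝ≥0∞} {D D' : ℝ≥0} (h : NeighbourBound γ D) (hD : D ≤ D') :
    NeighbourBound γ D' := fun b b' s h0 h1 h2 h3 h4 h5 =>
  ⟨(h b b' s h0 h1 h2 h3 h4 h5).1.trans (by gcongr),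
    (h b b' s h0 h1 h2 h3 h4 h5).2.trans (by gcongr)⟩

theorem admissible_of_bounds {p : ℝ≥0∞} (hp : 1 ≤ p) (hpt : p ≠ ∞) {γ : ℝ → ℝ≥0∞}
    (hγ : IsWeight γ) (hfin : mass γ (Set.Icc (-pi) pi) < ∞) {B D : ℝ≥0} (hB : MeanBound p.toReal γ B) (hD : NeighbourBound γ D) :
    ∃ C : ℝ≥0, Admissible p γ C := by
  have hq : 1 ≤ p.toReal := by
    rw [← ENNReal.toReal_one]; exact ENNReal.toReal_mono hpt hp
  have hp0 : p ≠ 0 := by positivity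
  -- The bound on cells also compares a cell with itself, hence the constant `max 1 D`.
  set E : ℝ≥0 := 3 * 6 ^ p.toReal * max 1 D * B with hE
  have hEcoe : (E : ℝ≥0∞) = 3 * 6 ^ p.toReal * (max 1 D : ℝ≥0) * B := by
    rw [hE]; push_cast
    rw [ENNReal.coe_rpow_of_nonneg _ (by linarith)]; norm_cast
  have small : ∀ v : ℝ, 0 < v → v ≤ 2 * pi → ∀ u : ℝ → ℝ≥0∞, Function.Periodic u (2 * pi) →
      AEMeasurable u volume → eLpNorm (avg v u) p (weightedMeasure γ) ≤
      (E ^ (1 / p.toReal) : ℝ≥0) * eLpNorm u p (weightedMeasure γ) := by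
    intro v hv hv2 u hu hum
    rw [eLpNorm_weightedMeasure hp0 hpt hγ.aemeasurable (measurable_avg hum v).aemeasurable,
      eLpNorm_weightedMeasure hp0 hpt hγ.aemeasurable hum,
      ENNReal.coe_rpow_of_nonneg _ (by positivity), ← ENNReal.mul_rpow_of_nonneg _ _ (by positivity)]
    refine ENNReal.rpow_le_rpow ?_ (by positivity)
    rw [hEcoe]
    exact lintegral_avg_rpow_le_of_le hq hγ.aemeasurable hγ.periodic (le_max_left _ _) hB
      (hD.mono (le_max_right _ _)) hv hv2 hu hum
  have : IsFiniteMeasure (weightedMeasure γ) := isFiniteMeasure_withDensity hfin.ne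
  refine ⟨2 * E ^ (1 / p.toReal), hp, memLp_const 1, hγ.absolutelyContinuous, fun v hv u hu hum => ?_⟩
  rcases le_total v (2 * pi) with h | h
  · refine (small v hv h u hu hum).trans ?_
    gcongr
    exact le_mul_of_one_le_left (by positivity) (by norm_num)
  · calc eLpNorm (avg v u) p (weightedMeasure γ)
        ≤ 2 * eLpNorm (avg (2 * pi) u) p (weightedMeasure γ) := by
          refine eLpNorm_le_mul_eLpNorm_of_ae_le_mul'' (c := 2) p
            (measurable_avg hum _).aestronglyMeasurable (Filter.Eventually.of_forall fun x => ?_)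
          simpa using avg_le_two_mul_avg_period hu h x
      _ ≤ 2 * ((E ^ (1 / p.toReal) : ℝ≥0) * eLpNorm u p (weightedMeasure γ)) := by
          gcongr; exact small _ (by positivity) le_rfl u hu hum
      _ = _ := by push_cast; ring

/-- The constant 2 reflects the normalisation of `avg`: a window of length 2v is divided by v. -/
theorem admissible_top {γ : ℝ → ℝ≥0∞} (hγ : IsWeight γ) :
    Admissible ∞ γ 2 := by
  refine ⟨le_top, memLp_top_const 1, hγ.absolutelyContinuous, fun v hv u hu hum => ?_⟩
  rw [eLpNorm_exponent_top, eLpNorm_exponent_top]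
  set S := eLpNormEssSup u (weightedMeasure γ) with hS
  have hae : ∀ᵐ x, u x ≤ S := by
    refine ae_of_periodic (fun x => by rw [hu x]) ?_
    have := hγ.absolutelyContinuous.ae_le (ae_le_eLpNormEssSup (f := u) (μ := weightedMeasure γ))
    filter_upwards [this] with x hx using by simpa using hx
  refine eLpNormEssSup_le_of_ae_enorm_bound (Filter.Eventually.of_forall fun x => ?_)
  rw [enorm_eq_self]
  unfold avg
  rw [lintegral_Icc_add]
  calc (ENNReal.ofReal v)⁻¹ * ∫⁻ t in Set.Icc (x + -v) (x + v), u t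
      ≤ (ENNReal.ofReal v)⁻¹ * ∫⁻ t in Set.Icc (x + -v) (x + v), S := by
        gcongr 1
        exact lintegral_mono_ae (ae_restrict_of_ae hae)
    _ = ((ENNReal.ofReal v)⁻¹ * ENNReal.ofReal v) * 2 * S := by
        rw [setLIntegral_const, Real.volume_Icc, show x + v - (x + -v) = v * 2 by ring,
          ENNReal.ofReal_mul hv.le, ENNReal.ofReal_ofNat]; ring
    _ = _ := by
        rw [ENNReal.inv_mul_cancel (by simpa using hv) ENNReal.ofReal_ne_top, one_mul]; rfl

theorem ClassAS.admissible {p : ℝ≥0∞} {γ : ℝ → ℝ≥0∞} (h : ClassAS p γ) :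
    ∃ C : ℝ≥0, Admissible p γ C := by
  rcases h with ⟨rfl, h⟩ | ⟨h1, h2, h⟩ | ⟨rfl, h, -⟩
  · obtain ⟨B, hB⟩ := h.meanBound
    obtain ⟨D, hD⟩ := h.neighbourBound
    refine admissible_of_bounds le_rfl ENNReal.one_ne_top h.1 ?_ (by simpa using hB) hD
    exact (mass_Icc_le_of_meanConst le_rfl (by linarith [pi_pos]) le_rfl).trans_lt
      (ENNReal.mul_lt_top h.2.1 ENNReal.ofReal_lt_top)
  · obtain ⟨B, hB⟩ := h.meanBound (by
      rw [← ENNReal.toReal_one]; exact (ENNReal.toReal_lt_toReal ENNReal.one_ne_top h2.ne).2 h1)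
    obtain ⟨D, hD⟩ := h.1.neighbourBound
    exact admissible_of_bounds h1.le h2.ne h.1.isWeight h.1.integrable hB hD
  · exact ⟨2, admissible_top h⟩

/-! ### Steklov means as bounded operators on the weighted space. -/

section

variable {p : ℝ≥0∞} {γ : ℝ → ℝ≥0∞} {C : ℝ≥0}

theorem enorm_intervalIntegral_le (f : ℝ → ℝ) {a b c d : ℝ} (hca : c ≤ min a b) (hbd : max a b ≤ d) :
    ‖∫ t in a..b, f t‖ₑ ≤ ∫⁻ t in Set.Icc c d, ‖f t‖ₑ := by
  have h : ‖∫ t in a..b, f t‖ₑ = ‖∫ t in Set.uIoc a b, f t‖ₑ := by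
    rw [← enorm_norm, intervalIntegral.norm_integral_eq_norm_integral_uIoc, enorm_norm]
  rw [h]
  refine (enorm_integral_le_lintegral_enorm _).trans (lintegral_mono_set ?_)
  exact Set.Ioc_subset_Icc_self.trans (Set.Icc_subset_Icc hca hbd)

theorem avg_eq (v : ℝ) (u : ℝ → ℝ≥0∞) (x : ℝ) :
    avg v u x = (ENNReal.ofReal v)⁻¹ * ∫⁻ t in Set.Icc (x - v) (x + v), u t := by
  rw [avg, lintegral_Icc_add, sub_eq_add_neg]

theorem lintegral_window_eq {v : ℝ} (hv : 0 < v) (u : ℝ → ℝ≥0∞) (x : ℝ) :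
    ∫⁻ t in Set.Icc (-v) v, u (x + t) = ENNReal.ofReal v * avg v u x := by
  rw [avg, ← mul_assoc, ENNReal.mul_inv_cancel (by simpa using hv) ENNReal.ofReal_ne_top, one_mul]

namespace Admissible

theorem weightedMeasure_ne_zero (h : Admissible p γ C) : weightedMeasure γ ≠ 0 := by
  intro h0
  have := h.ac
  rw [h0, Measure.absolutelyContinuous_zero_iff, Measure.restrict_eq_zero, Real.volume_Icc,
    ENNReal.ofReal_eq_zero] at this
  linarith [pi_pos]

theorem aemeasurable (h : Admissible p γ C) {f : ℝ → ℝ} (hf : f ∈ wLp p γ) :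
    AEMeasurable f volume :=
  aemeasurable_of_periodic hf.1 (hf.2.1.mono_ac h.ac).aemeasurable

theorem wnorm_avg_le (h : Admissible p γ C) {f : ℝ → ℝ} (hper : Function.Periodic f (2 * pi))
    (hf : AEMeasurable f volume) {v : ℝ} (hv : 0 < v) :
    eLpNorm (avg v fun t => ‖f t‖ₑ) p (weightedMeasure γ) ≤ C * wnorm p γ f := by
  refine (h.avg_le v hv (fun t => ‖f t‖ₑ) (fun x => by simp only [hper x]) hf.enorm).trans_eq ?_
  rw [eLpNorm_enorm]; rfl

/-- Together with `wnorm_le_of_sum_avg`, this converts the pointwise estimates below into norm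
estimates. -/
theorem wnorm_le_of_avg (h : Admissible p γ C) {f : ℝ → ℝ} (hper : Function.Periodic f (2 * pi))
    (hf : AEMeasurable f volume) {v : ℝ} (hv : 0 < v) {F : ℝ → ℝ} {c : ℝ≥0∞}
    (hF : ∀ x, ‖F x‖ₑ ≤ c * avg v (fun t => ‖f t‖ₑ) x) :
    wnorm p γ F ≤ c * (C * wnorm p γ f) := by
  refine (eLpNorm_le_mul_eLpNorm_of_ae_le_mul'' (c := c) p
    (measurable_avg hf.enorm v).aestronglyMeasurable
    (Filter.Eventually.of_forall fun x => ?_)).trans ?_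
  · simpa using hF x
  · gcongr; exact h.wnorm_avg_le hper hf hv

/-- If f were not integrable over a period, its averages with v = 2π would be infinite everywhere,
hence of infinite norm, against the boundedness of averages. -/
theorem intervalIntegrable (h : Admissible p γ C) {f : ℝ → ℝ} (hf : f ∈ wLp p γ) (a b : ℝ) :
    IntervalIntegrable f volume a b := by
  have hp := pi_pos
  have hm := h.aemeasurable hf
  have hx : ∃ x, avg (2 * pi) (fun t => ‖f t‖ₑ) x ≠ ∞ := by
    by_contra! hcon
    have h1 := h.wnorm_avg_le hf.1 hm (v := 2 * pi) (by positivity)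
    have h2 : avg (2 * pi) (fun t => ‖f t‖ₑ) = fun _ => ∞ := funext hcon
    have hp0 : p ≠ 0 := (zero_lt_one.trans_le h.one_le).ne'
    rw [h2, eLpNorm_const _ hp0 h.weightedMeasure_ne_zero, enorm_eq_self, ENNReal.top_mul] at h1
    · exact (ENNReal.mul_lt_top ENNReal.coe_lt_top hf.2.2).not_ge h1
    · rw [Ne, ENNReal.rpow_eq_zero_iff]
      rintro (⟨h3, -⟩ | ⟨-, h3⟩)
      · exact h.weightedMeasure_ne_zero (Measure.measure_univ_eq_zero.1 h3)
      · have : 0 ≤ 1 / p.toReal := by positivity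
        linarith
  obtain ⟨x, hx⟩ := hx
  refine hf.1.intervalIntegrable (t := x) (by positivity) ?_ a b
  rw [intervalIntegrable_iff_integrableOn_Ioc_of_le (by linarith)]
  refine ⟨hm.restrict.aestronglyMeasurable, ?_⟩
  refine lt_of_le_of_lt (lintegral_mono_set (t := Set.Icc (x - 2 * pi) (x + 2 * pi)) ?_) ?_
  · exact Set.Ioc_subset_Icc_self.trans (Set.Icc_subset_Icc (by linarith) le_rfl)
  · have := lintegral_window_eq (v := 2 * pi) (by positivity) (fun t => ‖f t‖ₑ) x
    rw [lintegral_Icc_add (fun t => ‖f t‖ₑ), ← sub_eq_add_neg] at this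
    rw [this]
    exact ENNReal.mul_lt_top ENNReal.ofReal_lt_top hx.lt_top

end Admissible

theorem enorm_steklov_le {v : ℝ} (hv : 0 < v) (f : ℝ → ℝ) (x : ℝ) :
    ‖steklov v f x‖ₑ ≤ avg v (fun t => ‖f t‖ₑ) x := by
  rw [steklov, if_neg hv.ne', avg_eq, enorm_mul, one_div, enorm_inv hv.ne', Real.enorm_eq_ofReal hv.le]
  gcongr
  refine enorm_intervalIntegral_le f ?_ ?_
  · rw [min_eq_left (by linarith)]; linarith
  · rw [max_eq_right (by linarith)]

theorem steklov_periodic {f : ℝ → ℝ} (hf : Function.Periodic f (2 * pi)) {v : ℝ} (hv : v ≠ 0) :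
    Function.Periodic (steklov v f) (2 * pi) := by
  intro x
  simp only [steklov, if_neg hv]
  rw [show x + 2 * pi + v = (x + v) + 2 * pi by ring,
    ← intervalIntegral.integral_comp_add_right (f := f)]
  simp only [hf _]

theorem steklov_eq_sub {f : ℝ → ℝ} (hf : ∀ a b, IntervalIntegrable f volume a b) {v : ℝ} (hv : v ≠ 0)
    (x : ℝ) : steklov v f x = (1 / v) * ((∫ t in (0 : ℝ)..(x + v), f t) - ∫ t in (0 : ℝ)..x, f t) := by
  rw [steklov, if_neg hv, intervalIntegral.integral_interval_sub_left (hf _ _) (hf _ _)]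

theorem continuous_steklov {f : ℝ → ℝ} (hf : ∀ a b, IntervalIntegrable f volume a b) {v : ℝ}
    (hv : v ≠ 0) : Continuous (steklov v f) := by
  rw [funext (steklov_eq_sub hf hv)]
  have := intervalIntegral.continuous_primitive hf 0
  exact continuous_const.mul ((this.comp (continuous_id.add continuous_const)).sub this)

theorem hasDerivAt_steklov {f : ℝ → ℝ} (hf : Continuous f) {v : ℝ} (hv : v ≠ 0) (x : ℝ) :
    HasDerivAt (steklov v f) ((1 / v) * (f (x + v) - f x)) x := by
  rw [funext (steklov_eq_sub (fun a b => hf.intervalIntegrable a b) hv)]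
  have key : ∀ y, HasDerivAt (fun b => ∫ t in (0 : ℝ)..b, f t) (f y) y := fun y =>
    intervalIntegral.integral_hasDerivAt_right (hf.intervalIntegrable _ _)
      (hf.stronglyMeasurableAtFilter _ _) hf.continuousAt
  exact (((key (x + v)).comp_add_const x v).sub (key x)).const_mul _

theorem Admissible.steklov_mem (h : Admissible p γ C) {f : ℝ → ℝ} (hf : f ∈ wLp p γ) {v : ℝ}
    (hv : 0 < v) : wnorm p γ (steklov v f) ≤ C * wnorm p γ f ∧ steklov v f ∈ wLp p γ := by
  have h1 : wnorm p γ (steklov v f) ≤ C * wnorm p γ f := by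
    have := h.wnorm_le_of_avg hf.1 (h.aemeasurable hf) hv (F := steklov v f) (c := 1)
      (fun x => by rw [one_mul]; exact enorm_steklov_le hv f x)
    rwa [one_mul] at this
  exact ⟨h1, steklov_periodic hf.1 hv.ne',
    (continuous_steklov (h.intervalIntegrable hf) hv.ne').aestronglyMeasurable,
    h1.trans_lt (ENNReal.mul_lt_top ENNReal.coe_lt_top hf.2.2)⟩

variable (p γ) in
/-- The space `L_{p,γ}` as a subspace of the space of all functions. -/
def wLpSpace : Submodule ℝ (ℝ → ℝ) where
  carrier := wLp p γ
  add_mem' hf hg := ⟨hf.1.add hg.1, hf.2.add hg.2⟩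
  zero_mem' := ⟨fun _ => rfl, MemLp.zero⟩
  smul_mem' c _ hf := ⟨hf.1.smul c, hf.2.const_smul c⟩

theorem wnorm_add_le (hp : 1 ≤ p) (f g : wLpSpace p γ) :
    wnorm p γ (f + g : wLpSpace p γ) ≤ wnorm p γ f + wnorm p γ g :=
  eLpNorm_add_le f.2.2.1 g.2.2.1 hp

theorem wnorm_sub_le (hp : 1 ≤ p) (f g : wLpSpace p γ) :
    wnorm p γ (f - g : wLpSpace p γ) ≤ wnorm p γ f + wnorm p γ g :=
  eLpNorm_sub_le f.2.2.1 g.2.2.1 hp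

/-- The Steklov mean as a linear operator on `L_{p,γ}`. -/
def steklovEnd (h : Admissible p γ C) (v : ℝ) (hv : 0 < v) : Module.End ℝ (wLpSpace p γ) where
  toFun f := ⟨steklov v f, (h.steklov_mem f.2 hv).2⟩
  map_add' f g := by
    ext x
    simp only [steklov, if_neg hv.ne', Submodule.coe_add, Pi.add_apply]
    rw [intervalIntegral.integral_add (h.intervalIntegrable f.2 _ _)
      (h.intervalIntegrable g.2 _ _), mul_add]
  map_smul' c f := by
    ext x
    simp only [steklov, if_neg hv.ne', Submodule.coe_smul, Pi.smul_apply, smul_eq_mul,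
      RingHom.id_apply, intervalIntegral.integral_const_mul]
    ring

/-- Moves the modulus of smoothness into the ring of endomorphisms, where polynomial identities in T
are available. -/
theorem coe_one_sub_steklovEnd_pow (h : Admissible p γ C) {v : ℝ} (hv : 0 < v) (k : ℕ)
    (f : wLpSpace p γ) :
    (((1 - steklovEnd h v hv) ^ k) f : ℝ → ℝ) = (steklovDiff v)^[k] f := by
  induction k with
  | zero => rfl
  | succ k ih =>
    rw [pow_succ', Function.iterate_succ_apply', ← ih]
    rfl

/-- `L` is bounded by `K` for the norm of `L_{p,γ}`. -/
def BoundedBy (L : Module.End ℝ (wLpSpace p γ)) (K : ℝ≥0) : Prop :=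
  ∀ f, wnorm p γ (L f) ≤ K * wnorm p γ f

namespace BoundedBy

variable {L L' : Module.End ℝ (wLpSpace p γ)} {K K' : ℝ≥0}

theorem one : BoundedBy (1 : Module.End ℝ (wLpSpace p γ)) 1 := fun f => by
  simp

theorem mul (h : BoundedBy L K) (h' : BoundedBy L' K') : BoundedBy (L * L') (K * K') := fun f =>
  calc _ ≤ K * wnorm p γ (L' f) := h _
    _ ≤ K * (K' * wnorm p γ f) := by gcongr; exact h' f
    _ = _ := by push_cast; ring

theorem add (hp : 1 ≤ p) (h : BoundedBy L K) (h' : BoundedBy L' K') :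
    BoundedBy (L + L') (K + K') := fun f =>
  calc _ ≤ wnorm p γ (L f) + wnorm p γ (L' f) := wnorm_add_le hp _ _
    _ ≤ K * wnorm p γ f + K' * wnorm p γ f := add_le_add (h f) (h' f)
    _ = _ := by push_cast; ring

theorem sub (hp : 1 ≤ p) (h : BoundedBy L K) (h' : BoundedBy L' K') :
    BoundedBy (L - L') (K + K') := fun f =>
  calc _ ≤ wnorm p γ (L f) + wnorm p γ (L' f) := wnorm_sub_le hp _ _
    _ ≤ K * wnorm p γ f + K' * wnorm p γ f := add_le_add (h f) (h' f)
    _ = _ := by push_cast; ring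

theorem pow (h : BoundedBy L K) (n : ℕ) : BoundedBy (L ^ n) (K ^ n) := by
  induction n with
  | zero => simpa using one
  | succ n ih => rw [pow_succ, pow_succ]; exact ih.mul h

theorem sum_pow (hp : 1 ≤ p) (h : BoundedBy L K) (n : ℕ) :
    BoundedBy (∑ i ∈ Finset.range n, L ^ i) (∑ i ∈ Finset.range n, K ^ i) := by
  induction n with
  | zero => intro f; simp [wnorm]
  | succ n ih => rw [Finset.sum_range_succ, Finset.sum_range_succ]; exact ih.add hp (h.pow n)

end BoundedBy

theorem boundedBy_steklovEnd (h : Admissible p γ C) {v : ℝ} (hv : 0 < v) :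
    BoundedBy (steklovEnd h v hv) C := fun f => (h.steklov_mem f.2 hv).1

/-! ### Increments of smooth functions and smoothing by Steklov means. -/

theorem enorm_sub_le_of_hasDerivAt {g g' : ℝ → ℝ} (hg : ∀ x, HasDerivAt g (g' x) x)
    (hg' : Continuous g') {x t r : ℝ} (ht : |t| ≤ r) :
    ‖g (x + t) - g x‖ₑ ≤ ∫⁻ s in Set.Icc (-r) r, ‖g' (x + s)‖ₑ := by
  rw [lintegral_Icc_add (fun t => ‖g' t‖ₑ), ← intervalIntegral.integral_eq_sub_of_hasDerivAt
    (fun y _ => hg y) (hg'.intervalIntegrable _ _)]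
  obtain ⟨h1, h2⟩ := abs_le.1 ht
  refine enorm_intervalIntegral_le g' (le_min ?_ ?_) (max_le ?_ ?_) <;> linarith

/-- The difference is the mean of g(x) - g(t) over [x, x + v], and each such increment is at most
the integral of |g'| over the window. -/
theorem enorm_steklovDiff_le {g g' : ℝ → ℝ} (hg : ∀ x, HasDerivAt g (g' x) x)
    (hg' : Continuous g') {v : ℝ} (hv : 0 < v) (x : ℝ) :
    ‖steklovDiff v g x‖ₑ ≤ ENNReal.ofReal v * avg v (fun t => ‖g' t‖ₑ) x := by
  have hgc : Continuous g := continuous_iff_continuousAt.2 fun y => (hg y).continuousAt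
  set W := ENNReal.ofReal v * avg v (fun t => ‖g' t‖ₑ) x with hW
  have e : steklovDiff v g x = (1 / v) * ∫ t in x..(x + v), (g x - g t) := by
    rw [intervalIntegral.integral_sub (by simp) (hgc.intervalIntegrable _ _)]
    simp only [steklovDiff, steklov, if_neg hv.ne', intervalIntegral.integral_const, smul_eq_mul]
    field_simp
    ring
  have hb : ∀ t ∈ Set.Icc x (x + v), ‖g x - g t‖ₑ ≤ W := by
    intro t ht
    rw [hW, ← lintegral_window_eq hv, ← enorm_neg, neg_sub]
    have := enorm_sub_le_of_hasDerivAt hg hg' (x := x) (t := t - x) (r := v)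
      (abs_le.2 ⟨by linarith [ht.1], by linarith [ht.2]⟩)
    rwa [add_sub_cancel] at this
  rw [e, enorm_mul, one_div, enorm_inv hv.ne', Real.enorm_eq_ofReal hv.le]
  calc (ENNReal.ofReal v)⁻¹ * ‖∫ t in x..(x + v), (g x - g t)‖ₑ
      ≤ (ENNReal.ofReal v)⁻¹ * ∫⁻ t in Set.Icc x (x + v), ‖g x - g t‖ₑ := by
        gcongr
        exact enorm_intervalIntegral_le _ (le_min le_rfl (by linarith)) (max_le (by linarith) le_rfl)
    _ ≤ (ENNReal.ofReal v)⁻¹ * ∫⁻ t in Set.Icc x (x + v), W := by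
        gcongr 1
        exact setLIntegral_mono' measurableSet_Icc hb
    _ = W := by
        rw [setLIntegral_const, Real.volume_Icc, add_sub_cancel_left, mul_comm W, ← mul_assoc,
          ENNReal.inv_mul_cancel (by simpa using hv) ENNReal.ofReal_ne_top, one_mul]

theorem periodic_of_hasDerivAt {g g' : ℝ → ℝ} (hper : Function.Periodic g (2 * pi))
    (hg : ∀ x, HasDerivAt g (g' x) x) : Function.Periodic g' (2 * pi) := by
  intro x
  have h1 := (hg (x + 2 * pi)).comp_add_const x (2 * pi)
  rw [show (fun y => g (y + 2 * pi)) = g from funext hper] at h1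
  exact h1.unique (hg x)

theorem Admissible.wnorm_steklovDiff_le (h : Admissible p γ C) {g g' : ℝ → ℝ}
    (hper : Function.Periodic g (2 * pi)) (hg : ∀ x, HasDerivAt g (g' x) x) (hg' : Continuous g')
    {v : ℝ} (hv : 0 < v) :
    wnorm p γ (steklovDiff v g) ≤ ENNReal.ofReal v * (C * wnorm p γ g') :=
  h.wnorm_le_of_avg (periodic_of_hasDerivAt hper hg) hg'.measurable.aemeasurable hv
    fun x => enorm_steklovDiff_le hg hg' hv x

/-- Two means are taken because the first only makes f continuous; the second is then C¹, with
derivative a difference quotient of the first mean at step v. -/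
theorem Admissible.steklov_steklov_smooth (h : Admissible p γ C) {v : ℝ} (hv : 0 < v)
    {f : ℝ → ℝ} (hf : f ∈ wLp p γ) :
    ∃ g' : ℝ → ℝ, Continuous g' ∧ (∀ x, HasDerivAt (steklov v (steklov v f)) (g' x) x) ∧
      wnorm p γ g' ≤ ENNReal.ofReal (4 / v) * (C * wnorm p γ f) := by
  have hint := h.intervalIntegrable hf
  have hc := continuous_steklov hint hv.ne'
  refine ⟨fun x => (1 / v) * (steklov v f (x + v) - steklov v f x),
    continuous_const.mul ((hc.comp (continuous_id.add continuous_const)).sub hc),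
    hasDerivAt_steklov hc hv.ne', ?_⟩
  refine h.wnorm_le_of_avg hf.1 (h.aemeasurable hf) (v := 2 * v) (by positivity) fun x => ?_
  set I := ∫⁻ t in Set.Icc (x - 2 * v) (x + 2 * v), ‖f t‖ₑ with hI
  have hb : ∀ y, x ≤ y → y ≤ x + v → ‖steklov v f y‖ₑ ≤ ENNReal.ofReal (1 / v) * I := by
    intro y h1 h2
    rw [steklov, if_neg hv.ne', enorm_mul, Real.enorm_eq_ofReal (by positivity)]
    gcongr
    exact enorm_intervalIntegral_le f (le_min (by linarith) (by linarith))
      (max_le (by linarith) (by linarith))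
  have hI2 : I = ENNReal.ofReal (2 * v) * avg (2 * v) (fun t => ‖f t‖ₑ) x := by
    rw [← lintegral_window_eq (by positivity), lintegral_Icc_add (fun t => ‖f t‖ₑ), ← sub_eq_add_neg]
  calc ‖(1 / v) * (steklov v f (x + v) - steklov v f x)‖ₑ
      ≤ ENNReal.ofReal (1 / v) * (ENNReal.ofReal (1 / v) * I + ENNReal.ofReal (1 / v) * I) := by
        rw [enorm_mul, Real.enorm_eq_ofReal (by positivity : (0 : ℝ) ≤ 1 / v)]
        gcongr
        exact enorm_sub_le.trans (add_le_add (hb _ (by linarith) le_rfl)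
          (hb _ le_rfl (by linarith)))
    _ = (ENNReal.ofReal (1 / v) * (2 * ENNReal.ofReal (1 / v) * ENNReal.ofReal (2 * v))) *
          avg (2 * v) (fun t => ‖f t‖ₑ) x := by rw [hI2]; ring
    _ = _ := by
        congr 1
        rw [← ENNReal.ofReal_ofNat 2, ← ENNReal.ofReal_mul (by positivity),
          ← ENNReal.ofReal_mul (by positivity), ← ENNReal.ofReal_mul (by positivity)]
        congr 1
        field_simp
        norm_num

end

/-! ### Trigonometric polynomials. -/

section TrigPoly

variable {n : ℕ}

theorem trigPoly_add {U V : ℝ → ℝ} (hU : U ∈ trigPoly n) (hV : V ∈ trigPoly n) :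
    (fun x => U x + V x) ∈ trigPoly n := by
  obtain ⟨a, b, h⟩ := hU
  obtain ⟨a', b', h'⟩ := hV
  refine ⟨fun k => a k + a' k, fun k => b k + b' k, fun x => ?_⟩
  simp only [h, h', ← Finset.sum_add_distrib]
  exact Finset.sum_congr rfl fun k _ => by ring

theorem trigPoly_const_mul {U : ℝ → ℝ} (hU : U ∈ trigPoly n) (c : ℝ) :
    (fun x => c * U x) ∈ trigPoly n := by
  obtain ⟨a, b, h⟩ := hU
  refine ⟨fun k => c * a k, fun k => c * b k, fun x => ?_⟩
  simp only [h, Finset.mul_sum]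
  exact Finset.sum_congr rfl fun k _ => by ring

theorem trigPoly_sub {U V : ℝ → ℝ} (hU : U ∈ trigPoly n) (hV : V ∈ trigPoly n) :
    (fun x => U x - V x) ∈ trigPoly n := by
  have := trigPoly_add hU (trigPoly_const_mul hV (-1))
  simpa [sub_eq_add_neg] using this

theorem zero_mem_trigPoly : (fun _ => 0) ∈ trigPoly n := ⟨0, 0, fun x => by simp⟩

theorem trigPoly_sum {ι : Type*} (s : Finset ι) {U : ι → ℝ → ℝ} (hU : ∀ i ∈ s, U i ∈ trigPoly n) :
    (fun x => ∑ i ∈ s, U i x) ∈ trigPoly n := by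
  classical
  induction s using Finset.induction_on with
  | empty => simpa using zero_mem_trigPoly
  | insert i s hi ih =>
    simp only [Finset.sum_insert hi]
    exact trigPoly_add (hU i (Finset.mem_insert_self i s))
      (ih fun j hj => hU j (Finset.mem_insert_of_mem hj))

theorem trigPoly_mono {m : ℕ} (hmn : m ≤ n) : trigPoly m ⊆ trigPoly n := by
  rintro U ⟨a, b, h⟩
  refine ⟨fun k => if k < m + 1 then a k else 0, fun k => if k < m + 1 then b k else 0, fun x => ?_⟩
  rw [h, ← Finset.sum_subset (Finset.range_mono (Nat.succ_le_succ hmn))]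
  · refine Finset.sum_congr rfl fun k hk => ?_
    simp only [if_pos (show k < m + 1 from Finset.mem_range.1 hk)]
  · intro k _ hk
    rw [Finset.mem_range] at hk
    simp only [if_neg hk, zero_mul, add_zero]

theorem cos_mem_trigPoly {z : ℤ} (hz : z.natAbs ≤ n) : (fun x => Real.cos (z * x)) ∈ trigPoly n := by
  refine trigPoly_mono hz ⟨fun k => if k = z.natAbs then 1 else 0, 0, fun x => ?_⟩
  have e : Real.cos (z * x) = Real.cos ((z.natAbs : ℝ) * x) := by
    obtain ⟨k, rfl | rfl⟩ := Int.eq_nat_or_neg z <;> simp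
  simp [e]

theorem trigPoly_periodic {U : ℝ → ℝ} (hU : U ∈ trigPoly n) : Function.Periodic U (2 * pi) := by
  obtain ⟨a, b, h⟩ := hU
  intro x
  rw [h, h]
  refine Finset.sum_congr rfl fun k _ => ?_
  rw [mul_add, Real.cos_add_nat_mul_two_pi, Real.sin_add_nat_mul_two_pi]

theorem trigPoly_continuous {U : ℝ → ℝ} (hU : U ∈ trigPoly n) : Continuous U := by
  obtain ⟨a, b, h⟩ := hU
  rw [funext h]
  fun_prop

/-- The addition formulas separate x from t. The shift φ serves two uses: the identity for Steklov
means, and negation for convolution with a polynomial kernel. -/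
theorem trigPoly_average {α : Type*} [MeasurableSpace α] {ν : Measure α} {U : ℝ → ℝ}
    (hU : U ∈ trigPoly n) {φ : α → ℝ} (hφ : Measurable φ) {g : α → ℝ} (hg : Integrable g ν) :
    (fun x => ∫ t, U (x + φ t) * g t ∂ν) ∈ trigPoly n := by
  obtain ⟨a, b, h⟩ := hU
  have hc : ∀ k : ℕ, Integrable (fun t => Real.cos (k * φ t) * g t) ν := fun k =>
    hg.bdd_mul (c := 1) (by fun_prop) (Filter.Eventually.of_forall fun t => Real.abs_cos_le_one _)
  have hs : ∀ k : ℕ, Integrable (fun t => Real.sin (k * φ t) * g t) ν := fun k =>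
    hg.bdd_mul (c := 1) (by fun_prop) (Filter.Eventually.of_forall fun t => Real.abs_sin_le_one _)
  refine ⟨fun k => a k * (∫ t, Real.cos (k * φ t) * g t ∂ν) + b k * ∫ t, Real.sin (k * φ t) * g t ∂ν,
    fun k => -a k * (∫ t, Real.sin (k * φ t) * g t ∂ν) + b k * ∫ t, Real.cos (k * φ t) * g t ∂ν,
    fun x => ?_⟩
  have e : ∀ t, U (x + φ t) * g t = ∑ k ∈ Finset.range (n + 1),
      ((a k * Real.cos (k * x) + b k * Real.sin (k * x)) * (Real.cos (k * φ t) * g t) +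
        (b k * Real.cos (k * x) - a k * Real.sin (k * x)) * (Real.sin (k * φ t) * g t)) := by
    intro t
    rw [h, Finset.sum_mul]
    refine Finset.sum_congr rfl fun k _ => ?_
    rw [mul_add, Real.cos_add, Real.sin_add]
    ring
  simp only [e]
  have hi : ∀ k : ℕ, Integrable (fun t =>
      ((a k * Real.cos (k * x) + b k * Real.sin (k * x)) * (Real.cos (k * φ t) * g t) +
        (b k * Real.cos (k * x) - a k * Real.sin (k * x)) * (Real.sin (k * φ t) * g t))) ν :=
    fun k => ((hc k).const_mul _).add ((hs k).const_mul _)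
  rw [integral_finsetSum _ fun k _ => hi k]
  refine Finset.sum_congr rfl fun k _ => ?_
  rw [integral_add ((hc k).const_mul _) ((hs k).const_mul _), integral_const_mul, integral_const_mul]
  ring

theorem steklov_mem_trigPoly {U : ℝ → ℝ} (hU : U ∈ trigPoly n) {v : ℝ} (hv : 0 < v) :
    steklov v U ∈ trigPoly n := by
  have := trigPoly_average (ν := volume.restrict (Set.Ioc 0 v)) hU measurable_id
    (g := fun _ => 1 / v) (by simp)
  convert this using 1
  funext x
  rw [steklov, if_neg hv.ne', integral_mul_const, mul_comm]
  congr 1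
  have := intervalIntegral.integral_comp_add_left (a := 0) (b := v) U x
  rw [add_zero] at this
  rw [← this, intervalIntegral.integral_of_le hv.le]
  rfl

theorem steklovDiff_mem_trigPoly {U : ℝ → ℝ} (hU : U ∈ trigPoly n) {v : ℝ} (hv : 0 < v) :
    steklovDiff v U ∈ trigPoly n := trigPoly_sub hU (steklov_mem_trigPoly hU hv)

end TrigPoly

/-! ### Size of the Fejér kernel. -/

/-- The kernel `|∑_{j<M} e^{ijt}|²`, written as a cosine sum. -/
def fejer (M : ℕ) (t : ℝ) : ℝ :=
  ∑ j ∈ Finset.range M, ∑ l ∈ Finset.range M, Real.cos (((j : ℤ) - (l : ℤ) : ℤ) * t)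

theorem continuous_fejer (M : ℕ) : Continuous (fejer M) := by
  unfold fejer; fun_prop

theorem fejer_eq (M : ℕ) (t : ℝ) : fejer M t =
    (∑ j ∈ Finset.range M, Real.cos (j * t)) ^ 2 + (∑ j ∈ Finset.range M, Real.sin (j * t)) ^ 2 := by
  rw [sq, sq, Finset.sum_mul_sum, Finset.sum_mul_sum, fejer, ← Finset.sum_add_distrib]
  refine Finset.sum_congr rfl fun j _ => ?_
  rw [← Finset.sum_add_distrib]
  refine Finset.sum_congr rfl fun l _ => ?_
  push_cast
  rw [sub_mul, Real.cos_sub]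

theorem fejer_nonneg (M : ℕ) (t : ℝ) : 0 ≤ fejer M t := by rw [fejer_eq]; positivity

theorem fejer_neg (M : ℕ) (t : ℝ) : fejer M (-t) = fejer M t := by
  simp only [fejer, mul_neg, Real.cos_neg]

theorem fejer_le_sq (M : ℕ) (t : ℝ) : fejer M t ≤ M ^ 2 := by
  calc fejer M t ≤ ∑ j ∈ Finset.range M, ∑ l ∈ Finset.range M, (1 : ℝ) :=
        Finset.sum_le_sum fun j _ => Finset.sum_le_sum fun l _ => Real.cos_le_one _
    _ = M ^ 2 := by simp [sq]

/-- In complex form, |1 - e^{it}|² |∑ e^{ijt}|² = |1 - e^{iMt}|² ≤ 4. The real and imaginary parts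
are telescoped separately, shifted by half a frequency. -/
theorem four_mul_sin_sq_mul_fejer_le (M : ℕ) (t : ℝ) : 4 * Real.sin (t / 2) ^ 2 * fejer M t ≤ 4 := by
  have hc : ∀ M : ℕ, 2 * Real.sin (t / 2) * ∑ j ∈ Finset.range M, Real.cos (j * t) =
      Real.sin ((M - 1 / 2) * t) + Real.sin (t / 2) := by
    intro M
    induction M with
    | zero =>
      simp only [Finset.range_zero, Finset.sum_empty, mul_zero, Nat.cast_zero]
      rw [show ((0 : ℝ) - 1 / 2) * t = -(t / 2) by ring, Real.sin_neg]; ring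
    | succ M ih =>
      rw [Finset.sum_range_succ, mul_add, ih]
      have e1 : ((M + 1 : ℕ) - 1 / 2 : ℝ) * t = M * t + t / 2 := by push_cast; ring
      have e2 : ((M : ℝ) - 1 / 2) * t = M * t - t / 2 := by ring
      rw [e1, e2, Real.sin_add, Real.sin_sub]; ring
  have hs : ∀ M : ℕ, 2 * Real.sin (t / 2) * ∑ j ∈ Finset.range M, Real.sin (j * t) =
      Real.cos (t / 2) - Real.cos ((M - 1 / 2) * t) := by
    intro M
    induction M with
    | zero =>
      simp only [Finset.range_zero, Finset.sum_empty, mul_zero, Nat.cast_zero]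
      rw [show ((0 : ℝ) - 1 / 2) * t = -(t / 2) by ring, Real.cos_neg]; ring
    | succ M ih =>
      rw [Finset.sum_range_succ, mul_add, ih]
      have e1 : ((M + 1 : ℕ) - 1 / 2 : ℝ) * t = M * t + t / 2 := by push_cast; ring
      have e2 : ((M : ℝ) - 1 / 2) * t = M * t - t / 2 := by ring
      rw [e1, e2, Real.cos_add, Real.cos_sub]; ring
  have e : 4 * Real.sin (t / 2) ^ 2 * fejer M t =
      (Real.sin ((M - 1 / 2) * t) + Real.sin (t / 2)) ^ 2 +
      (Real.cos (t / 2) - Real.cos ((M - 1 / 2) * t)) ^ 2 := by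
    rw [← hc, ← hs, fejer_eq]; ring
  have h1 := Real.sin_sq_add_cos_sq ((M - 1 / 2) * t)
  have h2 := Real.sin_sq_add_cos_sq (t / 2)
  have h3 := Real.neg_one_le_cos ((M - 1 / 2) * t + t / 2)
  rw [Real.cos_add] at h3
  rw [e]
  nlinarith

/-- Jordan's inequality turns sin(t/2) into |t|/π. -/
theorem sq_mul_fejer_le (M : ℕ) {t : ℝ} (ht : |t| ≤ pi) : t ^ 2 * fejer M t ≤ pi ^ 2 := by
  have hs : |t| ≤ pi * |Real.sin (t / 2)| := by
    have h1 := Real.mul_le_sin (x := |t| / 2) (by positivity) (by linarith)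
    have h2 : Real.sin (|t| / 2) ≤ |Real.sin (t / 2)| := by
      rcases abs_cases t with ⟨h, -⟩ | ⟨h, -⟩
      · rw [h]; exact le_abs_self _
      · rw [h, neg_div, Real.sin_neg]; exact neg_le_abs _
    have hp := pi_pos
    calc |t| = pi * (2 / pi * (|t| / 2)) := by field_simp
      _ ≤ pi * |Real.sin (t / 2)| := by gcongr; exact h1.trans h2
  have h4 := four_mul_sin_sq_mul_fejer_le M t
  have h5 : t ^ 2 ≤ pi ^ 2 * Real.sin (t / 2) ^ 2 := by
    rw [← sq_abs t, ← sq_abs (Real.sin (t / 2)), ← mul_pow]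
    gcongr
  have h0 := fejer_nonneg M t
  nlinarith [mul_le_mul_of_nonneg_right h5 h0, sq_nonneg pi]

/-- The index is the least j with |t|M ≤ 2^j; it is at most J because |t| ≤ π ≤ 4. For j = 0 the
trivial bound M² is enough. Otherwise minimality gives |t|M > 2^(j-1), and the decay bound π²/t²
applies, with π² ≤ 10 and a factor 4 for the lost step. -/
theorem exists_dyadic_fejer_le {M J : ℕ} (hM : 1 ≤ M) (hJ : 4 * M ≤ 2 ^ J) {t : ℝ} (ht : |t| ≤ pi) :
    ∃ j ∈ Finset.range (J + 1), |t| ≤ 2 ^ j / M ∧ fejer M t ≤ 40 * M ^ 2 * (1 / 4) ^ j := by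
  have hM0 : (0 : ℝ) < M := by exact_mod_cast hM
  have hex : ∃ j, |t| * M ≤ 2 ^ j := by
    refine ⟨J, ?_⟩
    have : (4 : ℝ) * M ≤ 2 ^ J := by exact_mod_cast hJ
    nlinarith [Real.pi_le_four]
  classical
  have hspec := Nat.find_spec hex
  have hmin := fun m (hm : m < Nat.find hex) => Nat.find_min hex hm
  have hle : Nat.find hex ≤ J := Nat.find_min' hex (by
    have : (4 : ℝ) * M ≤ 2 ^ J := by exact_mod_cast hJ
    nlinarith [Real.pi_le_four])
  set j := Nat.find hex with hj
  refine ⟨j, by simp; omega, by rwa [le_div_iff₀ hM0], ?_⟩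
  rcases j with _ | i
  · have := fejer_le_sq M t
    nlinarith [sq_nonneg (M : ℝ)]
  · have h1 := hmin i (Nat.lt_succ_self i)
    push Not at h1
    have h2 := sq_mul_fejer_le M ht
    have h0 := fejer_nonneg M t
    have h3 : (2 : ℝ) ^ i * 2 ^ i < t ^ 2 * M ^ 2 := by
      have := mul_self_lt_mul_self (by positivity) h1
      rw [← sq_abs t]; linarith
    have h4 : ((2 : ℝ) ^ i * 2 ^ i) * fejer M t ≤ pi ^ 2 * M ^ 2 := by
      calc ((2 : ℝ) ^ i * 2 ^ i) * fejer M t ≤ (t ^ 2 * M ^ 2) * fejer M t := by gcongr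
        _ = (t ^ 2 * fejer M t) * M ^ 2 := by ring
        _ ≤ _ := by gcongr
    have h5 : pi ^ 2 ≤ 10 := by nlinarith [Real.pi_lt_d2, pi_pos]
    have h6 : (4 : ℝ) ^ i * fejer M t ≤ 10 * M ^ 2 := by
      have : (4 : ℝ) ^ i = 2 ^ i * 2 ^ i := by rw [← mul_pow]; norm_num
      rw [this]
      refine h4.trans ?_
      gcongr
    rw [one_div, inv_pow, ← div_eq_mul_inv, le_div_iff₀ (by positivity), pow_succ]
    linarith

/-- All phases jt are at most 1 in modulus, so each cosine is at least 1/2. -/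
theorem fejer_ge {M : ℕ} (hM : 1 ≤ M) {t : ℝ} (ht : |t| ≤ 1 / M) : (M : ℝ) ^ 2 / 4 ≤ fejer M t := by
  have hM0 : (0 : ℝ) < M := by exact_mod_cast hM
  have h1 : (M : ℝ) / 2 ≤ ∑ j ∈ Finset.range M, Real.cos (j * t) := by
    calc (M : ℝ) / 2 = ∑ j ∈ Finset.range M, (1 / 2 : ℝ) := by simp; ring
      _ ≤ _ := by
        refine Finset.sum_le_sum fun j hj => ?_
        have hjM : (j : ℝ) ≤ M := by exact_mod_cast (Finset.mem_range.1 hj).le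
        have h2 : |j * t| ≤ 1 := by
          rw [abs_mul, Nat.abs_cast]
          calc (j : ℝ) * |t| ≤ M * (1 / M) := by gcongr
            _ = 1 := by field_simp
        have h3 := Real.one_sub_sq_div_two_le_cos (x := j * t)
        have h4 : (j * t) ^ 2 ≤ 1 := by rw [← sq_abs]; exact pow_le_one₀ (abs_nonneg _) h2
        linarith
  rw [fejer_eq]
  nlinarith [sq_nonneg (∑ j ∈ Finset.range M, Real.sin (j * t)), sq_nonneg
    ((∑ j ∈ Finset.range M, Real.cos (j * t)) - M / 2)]

theorem integral_fejer_sq_ge {M : ℕ} (hM : 1 ≤ M) :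
    (M : ℝ) ^ 3 / 8 ≤ ∫ t in (-pi)..pi, fejer M t ^ 2 := by
  have hM0 : (0 : ℝ) < M := by exact_mod_cast hM
  have hM1 : (1 : ℝ) / M ≤ 1 := by rw [div_le_one hM0]; exact_mod_cast hM
  have hp := Real.pi_gt_three
  have hc : Continuous fun t => fejer M t ^ 2 := (continuous_fejer M).pow 2
  have h0 : (0 : ℝ) < 1 / M := by positivity
  calc (M : ℝ) ^ 3 / 8 = ∫ t in (-(1 / M : ℝ))..(1 / M), ((M : ℝ) ^ 2 / 4) ^ 2 := by
        rw [intervalIntegral.integral_const, smul_eq_mul]; field_simp; ring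
    _ ≤ ∫ t in (-(1 / M : ℝ))..(1 / M), fejer M t ^ 2 := by
        refine intervalIntegral.integral_mono_on (by linarith) (by simp)
          (hc.intervalIntegrable _ _) fun t ht => ?_
        have := fejer_ge hM (abs_le.2 ⟨ht.1, ht.2⟩)
        gcongr
    _ ≤ _ := by
        refine intervalIntegral.integral_mono_interval (by linarith) (by linarith) (by linarith)
          (Filter.Eventually.of_forall fun t => by positivity) (hc.intervalIntegrable _ _)

theorem fejer_sq_mem_trigPoly {M n : ℕ} (hM : 1 ≤ M) (h : 2 * (M - 1) ≤ n) :
    (fun t => fejer M t ^ 2) ∈ trigPoly n := by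
  have e : (fun t => fejer M t ^ 2) = fun t => ∑ j ∈ Finset.range M, ∑ l ∈ Finset.range M,
      ∑ i ∈ Finset.range M, ∑ m ∈ Finset.range M,
        ((1 / 2) * Real.cos (((j : ℤ) - l + (i - m) : ℤ) * t) +
          (1 / 2) * Real.cos (((j : ℤ) - l - (i - m) : ℤ) * t)) := by
    funext t
    rw [sq, fejer, Finset.sum_mul_sum]
    refine Finset.sum_congr rfl fun j _ => ?_
    simp only [Finset.sum_mul_sum]
    rw [Finset.sum_comm]
    refine Finset.sum_congr rfl fun l _ => Finset.sum_congr rfl fun i _ =>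
      Finset.sum_congr rfl fun m _ => ?_
    push_cast
    rw [add_mul _ _ t, sub_mul ((j : ℝ) - l), Real.cos_add, Real.cos_sub]
    ring
  rw [e]
  refine trigPoly_sum _ fun j hj => trigPoly_sum _ fun l hl => trigPoly_sum _ fun i hi =>
    trigPoly_sum _ fun m hm => ?_
  rw [Finset.mem_range] at hj hl hi hm
  exact trigPoly_add (trigPoly_const_mul (cos_mem_trigPoly (by omega)) _)
    (trigPoly_const_mul (cos_mem_trigPoly (by omega)) _)

/-! ### Differentiation of trigonometric polynomials by convolution. -/

theorem integral_cos_int_mul (z : ℤ) :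
    ∫ t in (-pi)..pi, Real.cos (z * t) = if z = 0 then 2 * pi else 0 := by
  split_ifs with h
  · simp [h]; ring
  · have hz : (z : ℝ) ≠ 0 := by exact_mod_cast h
    rw [intervalIntegral.integral_comp_mul_left _ hz, integral_cos]
    simp [Real.sin_int_mul_pi]

theorem integral_sin_mul_sin_nat (k : ℕ) {m : ℕ} (hm : 1 ≤ m) :
    ∫ t in (-pi)..pi, Real.sin (k * t) * Real.sin (m * t) = if k = m then pi else 0 := by
  have e : ∀ t, Real.sin (k * t) * Real.sin (m * t) =
      (1 / 2) * Real.cos (((k : ℤ) - m : ℤ) * t) - (1 / 2) * Real.cos (((k : ℤ) + m : ℤ) * t) := by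
    intro t
    push_cast
    rw [add_mul, sub_mul, Real.cos_add, Real.cos_sub]; ring
  simp only [e]
  rw [intervalIntegral.integral_sub (Continuous.intervalIntegrable (by fun_prop) _ _)
    (Continuous.intervalIntegrable (by fun_prop) _ _), intervalIntegral.integral_const_mul,
    intervalIntegral.integral_const_mul, integral_cos_int_mul, integral_cos_int_mul,
    if_neg (by omega : ¬ ((k : ℤ) + m = 0))]
  by_cases h : k = m
  · rw [if_pos h, if_pos (by omega)]; ring
  · rw [if_neg h, if_neg (by omega)]; ring

/-- Expanding sin((n + j - l)t) leaves a multiple of the double sum of sin((j - l)t), which vanishes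
by antisymmetry. The truncated subtraction is exact because l < n. -/
theorem fejer_mul_sin (n : ℕ) (t : ℝ) : fejer n t * Real.sin (n * t) =
    ∑ j ∈ Finset.range n, ∑ l ∈ Finset.range n, Real.sin (((n + j - l : ℕ) : ℝ) * t) := by
  have h0 : ∑ j ∈ Finset.range n, ∑ l ∈ Finset.range n, Real.sin (((j : ℝ) - l) * t) = 0 := by
    have h1 : ∑ j ∈ Finset.range n, ∑ l ∈ Finset.range n, Real.sin (((j : ℝ) - l) * t) =
        -∑ j ∈ Finset.range n, ∑ l ∈ Finset.range n, Real.sin (((j : ℝ) - l) * t) := by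
      conv_lhs => rw [Finset.sum_comm]
      rw [← Finset.sum_neg_distrib]
      refine Finset.sum_congr rfl fun j _ => ?_
      rw [← Finset.sum_neg_distrib]
      refine Finset.sum_congr rfl fun l _ => ?_
      rw [← Real.sin_neg]; congr 1; ring
    linarith
  have h2 : ∑ j ∈ Finset.range n, ∑ l ∈ Finset.range n, Real.sin (((n + j - l : ℕ) : ℝ) * t) =
      fejer n t * Real.sin (n * t) + Real.cos (n * t) *
        ∑ j ∈ Finset.range n, ∑ l ∈ Finset.range n, Real.sin (((j : ℝ) - l) * t) := by
    simp only [fejer, Finset.sum_mul, Finset.mul_sum]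
    rw [← Finset.sum_add_distrib]
    refine Finset.sum_congr rfl fun j _ => ?_
    rw [← Finset.sum_add_distrib]
    refine Finset.sum_congr rfl fun l hl => ?_
    rw [Finset.mem_range] at hl
    rw [Nat.cast_sub (by omega)]
    push_cast
    rw [show ((n : ℝ) + j - l) * t = n * t + ((j : ℝ) - l) * t by ring, Real.sin_add]
    ring
  rw [h2, h0]; ring

/-- By orthogonality only l = n + j - k contributes, and this is below n exactly when j < k; so k
values of j give π each. -/
theorem integral_sin_mul_fejer {n k : ℕ} (hk : k ≤ n) :
    ∫ t in (-pi)..pi, Real.sin (k * t) * (fejer n t * Real.sin (n * t)) = pi * k := by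
  simp only [fejer_mul_sin, Finset.mul_sum]
  rw [intervalIntegral.integral_finsetSum fun j _ => Continuous.intervalIntegrable (by fun_prop) _ _]
  have h1 : ∀ j ∈ Finset.range n, ∫ t in (-pi)..pi, ∑ l ∈ Finset.range n,
      Real.sin (k * t) * Real.sin (((n + j - l : ℕ) : ℝ) * t) = if j < k then pi else 0 := by
    intro j hj
    rw [Finset.mem_range] at hj
    rw [intervalIntegral.integral_finsetSum
      fun l _ => Continuous.intervalIntegrable (by fun_prop) _ _]
    have h2 : ∀ l ∈ Finset.range n, ∫ t in (-pi)..pi,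
        Real.sin (k * t) * Real.sin (((n + j - l : ℕ) : ℝ) * t) = if n + j - k = l then pi else 0 := by
      intro l hl
      rw [Finset.mem_range] at hl
      rw [integral_sin_mul_sin_nat k (by omega)]
      congr 1
      simp only [eq_iff_iff]
      omega
    rw [Finset.sum_congr rfl h2, Finset.sum_ite_eq]
    congr 1
    simp only [Finset.mem_range, eq_iff_iff]
    omega
  rw [Finset.sum_congr rfl h1, ← Finset.sum_filter]
  have h3 : (Finset.range n).filter (fun j => j < k) = Finset.range k := by
    ext j; simp; omega
  rw [h3]; simp [mul_comm]

theorem integral_cos_mul_fejer (n k : ℕ) :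
    ∫ t in (-pi)..pi, Real.cos (k * t) * (fejer n t * Real.sin (n * t)) = 0 := by
  have h := intervalIntegral.integral_comp_neg (a := -pi) (b := pi)
    (fun t => Real.cos (k * t) * (fejer n t * Real.sin (n * t)))
  simp only [mul_neg, Real.cos_neg, fejer_neg, Real.sin_neg, neg_neg,
    intervalIntegral.integral_neg] at h
  linarith

/-- The derivative of a trigonometric polynomial as a convolution. -/
theorem hasDerivAt_trigPoly {n : ℕ} {U : ℝ → ℝ} (hU : U ∈ trigPoly n) (x : ℝ) :
    HasDerivAt U ((1 / pi) * ∫ t in (-pi)..pi, U (x + t) * (fejer n t * Real.sin (n * t))) x := by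
  obtain ⟨a, b, h⟩ := hU
  have e : ∀ t, U (x + t) * (fejer n t * Real.sin (n * t)) = ∑ k ∈ Finset.range (n + 1),
      ((a k * Real.cos (k * x) + b k * Real.sin (k * x)) *
          (Real.cos (k * t) * (fejer n t * Real.sin (n * t))) +
        (b k * Real.cos (k * x) - a k * Real.sin (k * x)) *
          (Real.sin (k * t) * (fejer n t * Real.sin (n * t)))) := by
    intro t
    rw [h, Finset.sum_mul]
    refine Finset.sum_congr rfl fun k _ => ?_
    rw [mul_add, Real.cos_add, Real.sin_add]
    ring
  have hcont := continuous_fejer n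
  simp only [e]
  rw [intervalIntegral.integral_finsetSum fun k _ => Continuous.intervalIntegrable (by fun_prop) _ _]
  -- The kernel is odd, so only its sine moments survive; the k-th is πk, the factor produced by
  -- differentiation at frequency k.
  have h1 : ∀ k ∈ Finset.range (n + 1), ∫ t in (-pi)..pi,
      ((a k * Real.cos (k * x) + b k * Real.sin (k * x)) *
          (Real.cos (k * t) * (fejer n t * Real.sin (n * t))) +
        (b k * Real.cos (k * x) - a k * Real.sin (k * x)) *
          (Real.sin (k * t) * (fejer n t * Real.sin (n * t)))) =
      pi * (b k * (k * Real.cos (k * x)) - a k * (k * Real.sin (k * x))) := by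
    intro k hk
    rw [intervalIntegral.integral_add (Continuous.intervalIntegrable (by fun_prop) _ _)
      (Continuous.intervalIntegrable (by fun_prop) _ _), intervalIntegral.integral_const_mul,
      intervalIntegral.integral_const_mul, integral_cos_mul_fejer,
      integral_sin_mul_fejer (Nat.lt_succ_iff.1 (Finset.mem_range.1 hk))]
    ring
  rw [Finset.sum_congr rfl h1, ← Finset.mul_sum, ← mul_assoc, one_div, inv_mul_cancel₀ pi_pos.ne',
    one_mul, funext h]
  refine HasDerivAt.fun_sum fun k _ => ?_
  have hk : HasDerivAt (fun x : ℝ => (k : ℝ) * x) k x := by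
    simpa using (hasDerivAt_id x).const_mul (k : ℝ)
  exact ((hk.cos.const_mul (a k)).fun_add (hk.sin.const_mul (b k))).congr_deriv (by ring)

variable {p : ℝ≥0∞} {γ : ℝ → ℝ≥0∞} {C : ℝ≥0}

/-! ### Bernstein inequality. -/

theorem lintegral_le_sum_of_exists {s : Finset ℕ} {r : ℕ → ℝ} {A : Set ℝ} (hA : MeasurableSet A)
    {F : ℝ → ℝ≥0∞} {G : ℕ → ℝ → ℝ≥0∞} (hG : ∀ j, Measurable (G j))
    (h : ∀ t ∈ A, ∃ j ∈ s, |t| ≤ r j ∧ F t ≤ G j t) :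
    ∫⁻ t in A, F t ≤ ∑ j ∈ s, ∫⁻ t in Set.Icc (-r j) (r j), G j t := by
  calc ∫⁻ t in A, F t
      ≤ ∫⁻ t in A, ∑ j ∈ s, (Set.Icc (-r j) (r j)).indicator (G j) t := by
        refine setLIntegral_mono' hA fun t ht => ?_
        obtain ⟨j, hj, h1, h2⟩ := h t ht
        refine h2.trans (le_trans (le_of_eq ?_) (Finset.single_le_sum
          (f := fun j => (Set.Icc (-r j) (r j)).indicator (G j) t) (fun _ _ => zero_le) hj))
        rw [Set.indicator_of_mem]
        exact abs_le.1 h1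
    _ ≤ ∫⁻ t, ∑ j ∈ s, (Set.Icc (-r j) (r j)).indicator (G j) t := setLIntegral_le_lintegral _ _
    _ = ∑ j ∈ s, ∫⁻ t in Set.Icc (-r j) (r j), G j t := by
        rw [lintegral_finsetSum _ fun j _ => (hG j).indicator measurableSet_Icc]
        exact Finset.sum_congr rfl fun j _ => lintegral_indicator measurableSet_Icc _

theorem Admissible.wnorm_le_of_sum_avg (h : Admissible p γ C) {f : ℝ → ℝ}
    (hper : Function.Periodic f (2 * pi)) (hf : AEMeasurable f volume) {F : ℝ → ℝ} {s : Finset ℕ}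
    {c v : ℕ → ℝ} (hc : ∀ j, 0 ≤ c j) (hv : ∀ j, 0 < v j)
    (hF : ∀ x, ‖F x‖ₑ ≤ ∑ j ∈ s, ENNReal.ofReal (c j) * avg (v j) (fun t => ‖f t‖ₑ) x) :
    wnorm p γ F ≤ ENNReal.ofReal (∑ j ∈ s, c j) * (C * wnorm p γ f) := by
  have hm : ∀ j, Measurable fun x => ENNReal.ofReal (c j) * avg (v j) (fun t => ‖f t‖ₑ) x :=
    fun j => (measurable_avg hf.enorm _).const_mul _
  calc wnorm p γ F
      ≤ eLpNorm (∑ j ∈ s, fun x => ENNReal.ofReal (c j) * avg (v j) (fun t => ‖f t‖ₑ) x) p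
          (weightedMeasure γ) := by
        refine eLpNorm_mono_enorm fun x => ?_
        simpa using hF x
    _ ≤ ∑ j ∈ s, eLpNorm (fun x => ENNReal.ofReal (c j) * avg (v j) (fun t => ‖f t‖ₑ) x) p
          (weightedMeasure γ) := eLpNorm_sum_le (fun j _ => (hm j).aestronglyMeasurable) h.one_le
    _ ≤ ∑ j ∈ s, ENNReal.ofReal (c j) * (C * wnorm p γ f) := by
        refine Finset.sum_le_sum fun j _ => ?_
        refine (eLpNorm_le_mul_eLpNorm_of_ae_le_mul'' (c := ENNReal.ofReal (c j)) p
          (measurable_avg hf.enorm (v j)).aestronglyMeasurable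
          (Filter.Eventually.of_forall fun x => by simp)).trans ?_
        gcongr
        exact h.wnorm_avg_le hper hf (hv j)
    _ = _ := by rw [← Finset.sum_mul, ENNReal.ofReal_sum_of_nonneg fun j _ => hc j]

theorem sum_geometric_le {q : ℝ} (h0 : 0 ≤ q) (h1 : q ≤ 1 / 2) (n : ℕ) :
    ∑ j ∈ Finset.range n, q ^ j ≤ 2 :=
  (Finset.sum_le_sum fun j _ => pow_le_pow_left₀ h0 h1 j).trans (sum_geometric_two_le n)

theorem four_mul_le_two_pow (n : ℕ) : 4 * n ≤ 2 ^ (n + 2) := by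
  rw [pow_add]; have := (Nat.lt_two_pow_self (n := n)).le; omega

/-- On the window of half-length 2^j/n the kernel is at most 40n²4^{-j}; passing to the average
multiplies by 2^j/n and leaves 40n·2^{-j}, which sums to at most 80n. -/
theorem enorm_trigPoly_convolution_le {n : ℕ} (hn : 1 ≤ n) {U : ℝ → ℝ} (hU : Continuous U) (x : ℝ) :
    ‖(1 / pi) * ∫ t in (-pi)..pi, U (x + t) * (fejer n t * Real.sin (n * t))‖ₑ ≤
      ∑ j ∈ Finset.range (n + 3), ENNReal.ofReal (40 * n * (1 / 2) ^ j) *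
        avg (2 ^ j / n) (fun t => ‖U t‖ₑ) x := by
  have hn0 : (0 : ℝ) < n := by exact_mod_cast hn
  have hp := Real.pi_gt_three
  calc ‖(1 / pi) * ∫ t in (-pi)..pi, U (x + t) * (fejer n t * Real.sin (n * t))‖ₑ
      ≤ 1 * ∫⁻ t in Set.Icc (-pi) pi, ‖U (x + t) * (fejer n t * Real.sin (n * t))‖ₑ := by
        rw [enorm_mul]
        gcongr
        · rw [Real.enorm_eq_ofReal (by positivity), ENNReal.ofReal_le_one, div_le_one (by linarith)]
          linarith
        · exact enorm_intervalIntegral_le _ (le_min le_rfl (by linarith))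
            (max_le (by linarith) le_rfl)
    _ ≤ ∑ j ∈ Finset.range (n + 3), ∫⁻ t in Set.Icc (-(2 ^ j / n : ℝ)) (2 ^ j / n),
          ENNReal.ofReal (40 * n ^ 2 * (1 / 4) ^ j) * ‖U (x + t)‖ₑ := by
        rw [one_mul]
        refine lintegral_le_sum_of_exists (r := fun j => 2 ^ j / n)
          (G := fun j t => ENNReal.ofReal (40 * n ^ 2 * (1 / 4) ^ j) * ‖U (x + t)‖ₑ)
          measurableSet_Icc (fun j => ?_) fun t ht => ?_
        · exact ((hU.comp (continuous_const.add continuous_id)).measurable.enorm).const_mul _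
        · obtain ⟨j, hj, h1, h2⟩ := exists_dyadic_fejer_le hn (four_mul_le_two_pow n)
            (abs_le.2 ht)
          refine ⟨j, hj, h1, ?_⟩
          rw [enorm_mul, mul_comm]
          gcongr
          rw [Real.enorm_eq_ofReal_abs, abs_mul, abs_of_nonneg (fejer_nonneg n t)]
          refine ENNReal.ofReal_le_ofReal (le_trans ?_ h2)
          exact mul_le_of_le_one_right (fejer_nonneg n t) (Real.abs_sin_le_one _)
    _ = _ := by
        refine Finset.sum_congr rfl fun j _ => ?_
        rw [lintegral_const_mul' _ _ ENNReal.ofReal_ne_top,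
          lintegral_window_eq (by positivity) (fun t => ‖U t‖ₑ), ← mul_assoc,
          ← ENNReal.ofReal_mul (by positivity)]
        congr 2
        have : (1 / 4 : ℝ) ^ j = (1 / 2) ^ j * (1 / 2) ^ j := by rw [← mul_pow]; norm_num
        rw [this]
        have h2 : (1 / 2 : ℝ) ^ j * 2 ^ j = 1 := by rw [← mul_pow]; norm_num
        generalize (1 / 2 : ℝ) ^ j = y at h2 ⊢
        generalize (2 : ℝ) ^ j = z at h2 ⊢
        calc 40 * (n : ℝ) ^ 2 * (y * y) * (z / n) = 40 * n * y * (y * z) := by field_simp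
          _ = _ := by rw [h2, mul_one]

/-- Bernstein-type estimate for `𝕀 - 𝔗_v` on trigonometric polynomials. -/
theorem Admissible.wnorm_steklovDiff_trigPoly_le (h : Admissible p γ C) {n : ℕ} (hn : 1 ≤ n)
    {U : ℝ → ℝ} (hU : U ∈ trigPoly n) {v : ℝ} (hv : 0 < v) :
    wnorm p γ (steklovDiff v U) ≤ (80 * C ^ 2 : ℝ≥0) * ENNReal.ofReal (v * n) * wnorm p γ U := by
  have hUc := trigPoly_continuous hU
  have hfc := continuous_fejer n
  set U' : ℝ → ℝ := fun x =>
    (1 / pi) * ∫ t in (-pi)..pi, U (x + t) * (fejer n t * Real.sin (n * t)) with hU'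
  have hd : ∀ x, HasDerivAt U (U' x) x := hasDerivAt_trigPoly hU
  have hc : Continuous U' := by
    refine continuous_const.mul (intervalIntegral.continuous_parametric_intervalIntegral_of_continuous'
      ?_ _ _)
    fun_prop
  have hb : wnorm p γ U' ≤ ENNReal.ofReal (80 * n) * (C * wnorm p γ U) := by
    refine (h.wnorm_le_of_sum_avg (trigPoly_periodic hU) hUc.measurable.aemeasurable
      (c := fun j => 40 * n * (1 / 2) ^ j) (v := fun j => 2 ^ j / n) (fun j => by positivity)
      (fun j => ?_) (enorm_trigPoly_convolution_le hn hUc)).trans ?_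
    · have : (0 : ℝ) < n := by exact_mod_cast hn
      positivity
    · gcongr
      rw [← Finset.mul_sum]
      have := sum_geometric_le (q := 1 / 2) (by norm_num) le_rfl (n + 3)
      calc 40 * (n : ℝ) * ∑ j ∈ Finset.range (n + 3), (1 / 2 : ℝ) ^ j ≤ 40 * n * 2 := by gcongr
        _ = _ := by ring
  calc wnorm p γ (steklovDiff v U) ≤ ENNReal.ofReal v * (C * wnorm p γ U') :=
        h.wnorm_steklovDiff_le (trigPoly_periodic hU) hd hc hv
    _ ≤ ENNReal.ofReal v * (C * (ENNReal.ofReal (80 * n) * (C * wnorm p γ U))) := by gcongr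
    _ = _ := by
        rw [ENNReal.ofReal_mul hv.le, ENNReal.ofReal_mul (by norm_num), ENNReal.ofReal_ofNat]
        push_cast; ring

theorem Admissible.wnorm_steklovDiff_iterate_trigPoly_le (h : Admissible p γ C) {n : ℕ} (hn : 1 ≤ n)
    {U : ℝ → ℝ} (hU : U ∈ trigPoly n) {v : ℝ} (hv : 0 < v) (k : ℕ) :
    wnorm p γ ((steklovDiff v)^[k] U) ≤
      ((80 * C ^ 2 : ℝ≥0) * ENNReal.ofReal (v * n)) ^ k * wnorm p γ U := by
  induction k generalizing U with
  | zero => simp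
  | succ k ih =>
    rw [Function.iterate_succ_apply]
    refine (ih (steklovDiff_mem_trigPoly hU hv)).trans ?_
    rw [pow_succ _ k, mul_assoc]
    gcongr
    exact h.wnorm_steklovDiff_trigPoly_le hn hU hv

/-! ### Jackson inequality. -/

/-- The increment contributes one factor 2^j/M and the length of the window another, which would
cancel the decay 4^{-j} of the Fejér kernel. Its square decays like 16^{-j}, so 4^{-j} remains. The
normalising integral is at least M³/8. -/
theorem enorm_sub_convolution_le {M : ℕ} (hM : 1 ≤ M) {g g' : ℝ → ℝ}
    (hg : ∀ x, HasDerivAt g (g' x) x) (hg' : Continuous g') (x : ℝ) :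
    ‖g x - (∫ t in (-pi)..pi, fejer M t ^ 2)⁻¹ * ∫ t in (-pi)..pi, g (x + t) * fejer M t ^ 2‖ₑ ≤
      ∑ j ∈ Finset.range (M + 3), ENNReal.ofReal (25600 / M * (1 / 4) ^ j) *
        avg (2 ^ j / M) (fun t => ‖g' t‖ₑ) x := by
  have hM0 : (0 : ℝ) < M := by exact_mod_cast hM
  have hp := pi_pos
  have hgc : Continuous g := continuous_iff_continuousAt.2 fun y => (hg y).continuousAt
  have hfc := continuous_fejer M
  set c := ∫ t in (-pi)..pi, fejer M t ^ 2 with hc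
  have hc8 : (M : ℝ) ^ 3 / 8 ≤ c := integral_fejer_sq_ge hM
  have hc0 : 0 < c := lt_of_lt_of_le (by positivity) hc8
  have e : g x - c⁻¹ * ∫ t in (-pi)..pi, g (x + t) * fejer M t ^ 2 =
      -(c⁻¹ * ∫ t in (-pi)..pi, (g (x + t) - g x) * fejer M t ^ 2) := by
    simp only [sub_mul]
    rw [intervalIntegral.integral_sub (Continuous.intervalIntegrable (by fun_prop) _ _)
      (Continuous.intervalIntegrable (by fun_prop) _ _), intervalIntegral.integral_const_mul, ← hc]
    field_simp
    ring
  rw [e, enorm_neg, enorm_mul, Real.enorm_eq_ofReal (by positivity)]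
  set I : ℕ → ℝ≥0∞ := fun j => ENNReal.ofReal (2 ^ j / M) * avg (2 ^ j / M) (fun t => ‖g' t‖ₑ) x
    with hI
  calc ENNReal.ofReal c⁻¹ * ‖∫ t in (-pi)..pi, (g (x + t) - g x) * fejer M t ^ 2‖ₑ
      ≤ ENNReal.ofReal (8 / M ^ 3) *
          ∫⁻ t in Set.Icc (-pi) pi, ‖(g (x + t) - g x) * fejer M t ^ 2‖ₑ := by
        gcongr
        · rw [inv_le_comm₀ hc0 (by positivity), inv_div]; exact hc8
        · exact enorm_intervalIntegral_le _ (le_min le_rfl (by linarith))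
            (max_le (by linarith) le_rfl)
    _ ≤ ENNReal.ofReal (8 / M ^ 3) * ∑ j ∈ Finset.range (M + 3),
          ∫⁻ _ in Set.Icc (-(2 ^ j / M : ℝ)) (2 ^ j / M),
            I j * ENNReal.ofReal ((40 * M ^ 2 * (1 / 4) ^ j) ^ 2) := by
        gcongr
        refine lintegral_le_sum_of_exists (r := fun j => 2 ^ j / M)
          (G := fun j _ => I j * ENNReal.ofReal ((40 * M ^ 2 * (1 / 4) ^ j) ^ 2))
          measurableSet_Icc (fun j => measurable_const) fun t ht => ?_
        obtain ⟨j, hj, h1, h2⟩ := exists_dyadic_fejer_le hM (four_mul_le_two_pow M) (abs_le.2 ht)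
        refine ⟨j, hj, h1, ?_⟩
        rw [enorm_mul]
        gcongr
        · simp only [hI]
          rw [← lintegral_window_eq (by positivity)]
          exact enorm_sub_le_of_hasDerivAt hg hg' h1
        · rw [Real.enorm_eq_ofReal (by positivity)]
          gcongr
          exact fejer_nonneg M t
    _ = _ := by
        rw [Finset.mul_sum]
        refine Finset.sum_congr rfl fun j _ => ?_
        rw [setLIntegral_const, Real.volume_Icc, hI]
        simp only
        have e1 : ENNReal.ofReal (25600 / M * (1 / 4) ^ j) =
            ENNReal.ofReal (8 / M ^ 3) * ENNReal.ofReal (2 ^ j / M) *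
            ENNReal.ofReal ((40 * M ^ 2 * (1 / 4) ^ j) ^ 2) *
            ENNReal.ofReal (2 ^ j / M - -(2 ^ j / M)) := by
          rw [← ENNReal.ofReal_mul (by positivity), ← ENNReal.ofReal_mul (by positivity),
            ← ENNReal.ofReal_mul (by positivity)]
          congr 1
          have h2 : (1 / 4 : ℝ) ^ j * 2 ^ j * 2 ^ j = 1 := by
            rw [← mul_pow, ← mul_pow]; norm_num
          generalize (1 / 4 : ℝ) ^ j = y at h2 ⊢
          generalize (2 : ℝ) ^ j = z at h2 ⊢
          symm
          calc 8 / (M : ℝ) ^ 3 * (z / M) * (40 * M ^ 2 * y) ^ 2 * (z / M - -(z / M))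
              = 25600 / M * y * (y * z * z) := by field_simp; ring
            _ = _ := by rw [h2, mul_one]
        rw [e1]; ring

/-- Jackson-type estimate for continuously differentiable functions. -/
theorem Admissible.exists_trigPoly_of_hasDerivAt (h : Admissible p γ C) {N : ℕ} (hN : 1 ≤ N)
    {g g' : ℝ → ℝ} (hper : Function.Periodic g (2 * pi)) (hg : ∀ x, HasDerivAt g (g' x) x)
    (hg' : Continuous g') :
    ∃ V ∈ trigPoly N, wnorm p γ (fun x => g x - V x) ≤
      ENNReal.ofReal (102400 / N) * (C * wnorm p γ g') := by
  have hgc : Continuous g := continuous_iff_continuousAt.2 fun y => (hg y).continuousAt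
  -- The largest convenient M with 2(M - 1) ≤ N, the degree of the squared kernel; it still
  -- satisfies M ≥ N/2.
  set M := N / 2 + 1 with hM
  have hM1 : 1 ≤ M := by omega
  have hN0 : (0 : ℝ) < N := by exact_mod_cast hN
  have hM0 : (0 : ℝ) < M := by exact_mod_cast hM1
  have hNM : (N : ℝ) / 2 ≤ M := by
    have : N ≤ 2 * M := by omega
    have : (N : ℝ) ≤ 2 * M := by exact_mod_cast this
    linarith
  set c := ∫ t in (-pi)..pi, fejer M t ^ 2 with hc
  refine ⟨fun x => c⁻¹ * ∫ t in (-pi)..pi, g (x + t) * fejer M t ^ 2, ?_, ?_⟩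
  · refine trigPoly_const_mul ?_ _
    have hK := fejer_sq_mem_trigPoly (M := M) (n := N) hM1 (by omega)
    -- The convolution is a polynomial in x once the translation is moved onto the kernel; the
    -- substitution s = x + t, periodicity and evenness of the kernel identify the two forms.
    have := trigPoly_average (ν := volume.restrict (Set.Ioc (-pi) pi)) hK measurable_neg
      (g := g) (hgc.integrableOn_Icc.mono_set Set.Ioc_subset_Icc_self)
    convert this using 1
    funext x
    rw [← intervalIntegral.integral_of_le (by linarith [pi_pos])]
    have e1 := intervalIntegral.integral_comp_add_left (a := -pi) (b := pi)
      (fun s => fejer M (x + -s) ^ 2 * g s) x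
    have hp : Function.Periodic (fun s => fejer M (x + -s) ^ 2 * g s) (2 * pi) := by
      intro s
      have h1 := (trigPoly_periodic hK).sub_eq (x + -s)
      simp only at h1 ⊢
      rw [hper s, show x + -(s + 2 * pi) = x + -s - 2 * pi by ring, h1]
    have e2 := hp.intervalIntegral_add_eq (x + -pi) (-pi)
    rw [show x + -pi + 2 * pi = x + pi by ring, show -pi + 2 * pi = pi by ring] at e2
    rw [← e2, ← e1]
    refine intervalIntegral.integral_congr fun t _ => ?_
    rw [show x + -(x + t) = -t by ring, fejer_neg, mul_comm]
  · refine (h.wnorm_le_of_sum_avg (periodic_of_hasDerivAt hper hg) hg'.measurable.aemeasurable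
      (c := fun j => 25600 / M * (1 / 4) ^ j) (v := fun j => 2 ^ j / M) (fun j => by positivity)
      (fun j => by positivity) (enorm_sub_convolution_le hM1 hg hg')).trans ?_
    gcongr
    rw [← Finset.mul_sum]
    have := sum_geometric_le (q := 1 / 4) (by norm_num) (by norm_num) (M + 3)
    calc 25600 / (M : ℝ) * ∑ j ∈ Finset.range (M + 3), (1 / 4 : ℝ) ^ j ≤ 25600 / (N / 2) * 2 := by
          gcongr
      _ = _ := by field_simp; norm_num

/-! ### Direct theorem. -/

theorem Admissible.trigPoly_mem_wLp (h : Admissible p γ C) {n : ℕ} {U : ℝ → ℝ}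
    (hU : U ∈ trigPoly n) : U ∈ wLp p γ := by
  refine ⟨trigPoly_periodic hU, ?_⟩
  have hc := trigPoly_continuous hU
  obtain ⟨a, b, hab⟩ := hU
  refine h.memLp_one.of_le_mul (c := ∑ k ∈ Finset.range (n + 1), (|a k| + |b k|))
    hc.aestronglyMeasurable (Filter.Eventually.of_forall fun x => ?_)
  rw [norm_one, mul_one, Real.norm_eq_abs, hab]
  refine (Finset.abs_sum_le_sum_abs _ _).trans (Finset.sum_le_sum fun k _ => ?_)
  refine (abs_add_le _ _).trans (add_le_add ?_ ?_)
  · rw [abs_mul]; exact mul_le_of_le_one_right (abs_nonneg _) (Real.abs_cos_le_one _)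
  · rw [abs_mul]; exact mul_le_of_le_one_right (abs_nonneg _) (Real.abs_sin_le_one _)

/-- `L` maps trigonometric polynomials of degree at most `n` to such polynomials. -/
def PreservesTrigPoly (n : ℕ) (L : Module.End ℝ (wLpSpace p γ)) : Prop :=
  ∀ f : wLpSpace p γ, (f : ℝ → ℝ) ∈ trigPoly n → (L f : ℝ → ℝ) ∈ trigPoly n

namespace PreservesTrigPoly

variable {n : ℕ} {L L' : Module.End ℝ (wLpSpace p γ)}

theorem one : PreservesTrigPoly n (1 : Module.End ℝ (wLpSpace p γ)) := fun _ hf => hf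

theorem mul (h : PreservesTrigPoly n L) (h' : PreservesTrigPoly n L') :
    PreservesTrigPoly n (L * L') := fun f hf => h _ (h' f hf)

theorem add (h : PreservesTrigPoly n L) (h' : PreservesTrigPoly n L') :
    PreservesTrigPoly n (L + L') := fun f hf => trigPoly_add (h f hf) (h' f hf)

theorem sub (h : PreservesTrigPoly n L) (h' : PreservesTrigPoly n L') :
    PreservesTrigPoly n (L - L') := fun f hf => trigPoly_sub (h f hf) (h' f hf)

theorem pow (h : PreservesTrigPoly n L) (k : ℕ) : PreservesTrigPoly n (L ^ k) := by
  induction k with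
  | zero => simpa using one
  | succ k ih => rw [pow_succ]; exact ih.mul h

theorem sum_pow (h : PreservesTrigPoly n L) (k : ℕ) :
    PreservesTrigPoly n (∑ i ∈ Finset.range k, L ^ i) := by
  induction k with
  | zero => intro f _; rw [Finset.range_zero, Finset.sum_empty]; exact zero_mem_trigPoly
  | succ k ih => rw [Finset.sum_range_succ]; exact ih.add (h.pow k)

end PreservesTrigPoly

theorem bestApprox_le {n : ℕ} {f U : ℝ → ℝ} (hU : U ∈ trigPoly n) :
    bestApprox n f p γ ≤ wnorm p γ (fun x => f x - U x) := iInf₂_le U hU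

theorem Admissible.wnorm_iterate_le (h : Admissible p γ C) {v : ℝ} (hv : 0 < v) (k : ℕ)
    {f : ℝ → ℝ} (hf : f ∈ wLp p γ) :
    wnorm p γ ((steklovDiff v)^[k] f) ≤ ((1 + C) ^ k : ℝ≥0) * wnorm p γ f := by
  have := ((BoundedBy.one.sub h.one_le (boundedBy_steklovEnd h hv)).pow k) ⟨f, hf⟩
  rwa [coe_one_sub_steklovEnd_pow] at this

/-- The left side is (1 - t²)^k, and the geometric sum factors t² out of 1 - (1 - t²)^k. -/
theorem one_add_pow_mul_one_sub_pow {R : Type*} [Ring R] (t : R) (k : ℕ) :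
    (1 + t) ^ k * (1 - t) ^ k = 1 - t * t * ∑ i ∈ Finset.range k, (1 - t * t) ^ i := by
  have hcomm : Commute (1 + t) (1 - t) := by
    rw [Commute, SemiconjBy]; noncomm_ring
  have h1 : (1 + t) * (1 - t) = 1 - t * t := by noncomm_ring
  have h2 := mul_neg_geom_sum (1 - t * t) k
  rw [sub_sub_cancel] at h2
  rw [← hcomm.mul_pow, h2, h1, sub_sub_cancel]

/-- The recursive form of the direct theorem. -/
theorem Admissible.bestApprox_le_omega_add (h : Admissible p γ C) (k : ℕ) :
    ∃ K₁ K₂ : ℝ≥0, ∀ f ∈ wLp p γ, ∀ v : ℝ, 0 < v → ∀ N m : ℕ, 1 ≤ N → m ≤ N → ∀ U ∈ trigPoly m,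
      bestApprox N f p γ ≤ K₁ * Omega k f v p γ +
        K₂ * ENNReal.ofReal (1 / (N * v)) * wnorm p γ (fun x => f x - U x) := by
  set Q : ℝ≥0 := ∑ i ∈ Finset.range k, (1 + C * C) ^ i with hQ
  refine ⟨(1 + C) ^ k, 409600 * C ^ 2 * Q, fun f hf v hv N m hN hmN U hU => ?_⟩
  have hN0 : (0 : ℝ) < N := by exact_mod_cast hN
  have hp := h.one_le
  set T := steklovEnd h v hv with hT
  set S := ∑ i ∈ Finset.range k, (1 - T * T) ^ i with hS
  have hTb : BoundedBy T C := boundedBy_steklovEnd h hv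
  have hSb : BoundedBy S Q := (BoundedBy.one.sub hp (hTb.mul hTb)).sum_pow hp k
  have hTp : PreservesTrigPoly m T := fun f hf => steklov_mem_trigPoly hf hv
  have hSp : PreservesTrigPoly m S := (PreservesTrigPoly.one.sub (hTp.mul hTp)).sum_pow k
  have hid : (1 + T) ^ k * (1 - T) ^ k = 1 - T * T * S :=
    one_add_pow_mul_one_sub_pow T k
  let f' : wLpSpace p γ := ⟨f, hf⟩
  let u : wLpSpace p γ := ⟨U, h.trigPoly_mem_wLp hU⟩
  let w : wLpSpace p γ := f' - u
  obtain ⟨g', hg'c, hg', hg'n⟩ := h.steklov_steklov_smooth hv (S w).2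
  have hgper : Function.Periodic (steklov v (steklov v (S w))) (2 * pi) :=
    steklov_periodic (steklov_periodic (S w).2.1 hv.ne') hv.ne'
  obtain ⟨V, hV, hVn⟩ := h.exists_trigPoly_of_hasDerivAt hN hgper hg' hg'c
  let V' : wLpSpace p γ := ⟨V, h.trigPoly_mem_wLp hV⟩
  -- Only w = f - U has to be smoothed and approximated; T²SU already has degree at most m. This
  -- keeps the error term proportional to ‖f - U‖ rather than ‖f‖.
  have hP : (fun x => (((T * T * S) u : wLpSpace p γ) : ℝ → ℝ) x + V x) ∈ trigPoly N :=
    trigPoly_add (trigPoly_mono hmN ((hTp.mul hTp).mul hSp u hU)) hV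
  refine (bestApprox_le hP).trans ?_
  have hdec : (fun x => f x - ((((T * T * S) u : wLpSpace p γ) : ℝ → ℝ) x + V x)) =
      ((((1 + T) ^ k * (1 - T) ^ k) f' + ((T * T * S) w - V') : wLpSpace p γ) : ℝ → ℝ) := by
    have e : ((1 + T) ^ k * (1 - T) ^ k) f' + ((T * T * S) w - V') =
        f' - ((T * T * S) u + V') := by
      rw [hid, LinearMap.sub_apply, map_sub, Module.End.one_apply]; abel
    rw [e]; rfl
  rw [hdec]
  refine (wnorm_add_le hp _ _).trans (add_le_add ?_ ?_)
  · have h1 := ((BoundedBy.one.add hp hTb).pow k) (((1 - T) ^ k) f')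
    rw [Module.End.mul_apply]
    refine h1.trans_eq ?_
    rw [Omega, hT, coe_one_sub_steklovEnd_pow]
  · calc wnorm p γ ((T * T * S) w - V' : wLpSpace p γ)
        ≤ ENNReal.ofReal (102400 / N) * (C * wnorm p γ g') := hVn
      _ ≤ ENNReal.ofReal (102400 / N) * (C * (ENNReal.ofReal (4 / v) * (C * (Q * wnorm p γ w)))) := by
          gcongr
          refine hg'n.trans ?_
          gcongr
          exact hSb w
      _ = (ENNReal.ofReal (102400 / N) * ENNReal.ofReal (4 / v)) * (C ^ 2 * Q) * wnorm p γ w := by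
          ring
      _ = _ := by
          have e : ENNReal.ofReal (102400 / N) * ENNReal.ofReal (4 / v) =
              409600 * ENNReal.ofReal (1 / (N * v)) := by
            rw [← ENNReal.ofReal_mul (by positivity), ← ENNReal.ofReal_ofNat 409600,
              ← ENNReal.ofReal_mul (by norm_num)]
            congr 1
            field_simp
            norm_num
          rw [e]
          push_cast
          have : wnorm p γ w = wnorm p γ (fun x => f x - U x) := rfl
          rw [this]; ring

theorem Admissible.direct (h : Admissible p γ C) {β : ℝ} (hβ : 0 < β) {k : ℕ} {f : ℝ → ℝ}
    (hf : f ∈ wLp p γ) {C₀ : ℝ≥0}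
    (hΩ : ∀ δ : ℝ, 0 < δ → Omega k f δ p γ ≤ C₀ * ENNReal.ofReal (δ ^ β)) :
    ∃ K : ℝ≥0, ∀ n : ℕ, 1 ≤ n → bestApprox n f p γ ≤ K * ENNReal.ofReal ((n : ℝ) ^ (-β)) := by
  obtain ⟨K₁, K₂, hrec⟩ := h.bestApprox_le_omega_add k
  obtain ⟨F, hF⟩ : ∃ F : ℝ≥0, wnorm p γ f = F := ⟨_, (ENNReal.coe_toNNReal hf.2.2.ne).symm⟩
  -- A makes K₂3^β/A at most 1/4, so the recursive term, with 2K from the nearly best U, costs at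
  -- most K/2. The summand 2K₁C₀A^β of K lets the modulus term fit in the other half, and F covers N
  -- = 1.
  set A : ℝ := 4 * K₂ * 3 ^ β + 1 with hA
  have hA0 : 0 < A := by positivity
  set K : ℝ := 2 * K₁ * C₀ * A ^ β + F + 1 with hK
  have hK0 : 0 < K := by positivity
  have key : ∀ n : ℕ, 1 ≤ n → bestApprox n f p γ ≤ ENNReal.ofReal (K * (n : ℝ) ^ (-β)) := by
    intro n
    induction n using Nat.strong_induction_on with
    | _ N ih =>
    intro hN
    have hN0 : (0 : ℝ) < N := by exact_mod_cast hN
    rcases Nat.lt_or_ge N 2 with h2 | h2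
    · have : N = 1 := by omega
      subst this
      refine (bestApprox_le zero_mem_trigPoly).trans ?_
      simp only [sub_zero]
      rw [show wnorm p γ (fun x => f x) = F from hF, Nat.cast_one, Real.one_rpow, mul_one,
        ← ENNReal.ofReal_coe_nnreal]
      refine ENNReal.ofReal_le_ofReal ?_
      have : 0 ≤ 2 * K₁ * C₀ * A ^ β := by positivity
      linarith
    · set m := N / 2 with hm
      have hm1 : 1 ≤ m := by omega
      have hm0 : (0 : ℝ) < m := by exact_mod_cast hm1
      have hNm : (N : ℝ) / 3 ≤ m := by
        have : N ≤ 3 * m := by omega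
        have : (N : ℝ) ≤ 3 * m := by exact_mod_cast this
        linarith
      have hmβ : (m : ℝ) ^ (-β) ≤ 3 ^ β * (N : ℝ) ^ (-β) := by
        calc (m : ℝ) ^ (-β) ≤ (N / 3 : ℝ) ^ (-β) :=
              Real.rpow_le_rpow_of_nonpos (by positivity) hNm (by linarith)
          _ = 3 ^ β * (N : ℝ) ^ (-β) := by
              rw [Real.div_rpow hN0.le (by norm_num), Real.rpow_neg (by norm_num : (0 : ℝ) ≤ 3),
                div_inv_eq_mul, mul_comm]
      -- The factor 2 makes the inequality strict, so that an approximant can be extracted without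
      -- knowing that the infimum is attained.
      have hlt : bestApprox m f p γ < ENNReal.ofReal (2 * K * (m : ℝ) ^ (-β)) := by
        refine (ih m (by omega) hm1).trans_lt ?_
        rw [ENNReal.ofReal_lt_ofReal_iff (by positivity)]
        have : 0 < K * (m : ℝ) ^ (-β) := by positivity
        linarith
      obtain ⟨U, hU, hUlt⟩ : ∃ U ∈ trigPoly m,
          wnorm p γ (fun x => f x - U x) < ENNReal.ofReal (2 * K * (m : ℝ) ^ (-β)) := by
        simpa only [bestApprox, iInf_lt_iff, exists_prop] using hlt
      have hr := hrec f hf (A / N) (by positivity) N m hN (by omega) U hU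
      calc bestApprox N f p γ ≤ _ := hr
        _ ≤ K₁ * (C₀ * ENNReal.ofReal ((A / N) ^ β)) + K₂ * ENNReal.ofReal (1 / (N * (A / N))) *
            ENNReal.ofReal (2 * K * (m : ℝ) ^ (-β)) := by
          gcongr
          exact hΩ _ (by positivity)
        _ = ENNReal.ofReal (K₁ * (C₀ * (A / N) ^ β) +
              K₂ * (1 / (N * (A / N))) * (2 * K * (m : ℝ) ^ (-β))) := by
          rw [ENNReal.ofReal_add (by positivity) (by positivity), ENNReal.ofReal_mul (p := (K₁ : ℝ)) (by positivity),
            ENNReal.ofReal_mul (p := (C₀ : ℝ)) (by positivity),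
            ENNReal.ofReal_mul (p := K₂ * (1 / (N * (A / N)))) (by positivity),
            ENNReal.ofReal_mul (p := (K₂ : ℝ)) (by positivity)]
          simp only [ENNReal.ofReal_coe_nnreal]
        _ ≤ _ := by
          refine ENNReal.ofReal_le_ofReal ?_
          have e1 : (A / N) ^ β = A ^ β * (N : ℝ) ^ (-β) := by
            rw [Real.div_rpow hA0.le hN0.le, Real.rpow_neg hN0.le]; rfl
          have e2 : 1 / (N * (A / N)) = 1 / A := by field_simp
          have e3 : K₂ * (1 / A) * 3 ^ β ≤ 1 / 4 := by
            rw [mul_one_div, div_mul_eq_mul_div, div_le_iff₀ hA0]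
            linarith
          have hNβ : 0 < (N : ℝ) ^ (-β) := by positivity
          rw [e1, e2]
          calc K₁ * (C₀ * (A ^ β * (N : ℝ) ^ (-β))) + K₂ * (1 / A) * (2 * K * (m : ℝ) ^ (-β))
              ≤ K₁ * (C₀ * (A ^ β * (N : ℝ) ^ (-β))) +
                K₂ * (1 / A) * (2 * K * (3 ^ β * (N : ℝ) ^ (-β))) := by gcongr
            _ = (K₁ * C₀ * A ^ β + (K₂ * (1 / A) * 3 ^ β) * (2 * K)) * (N : ℝ) ^ (-β) := by ring
            _ ≤ (K₁ * C₀ * A ^ β + (1 / 4) * (2 * K)) * (N : ℝ) ^ (-β) := by gcongr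
            _ ≤ K * (N : ℝ) ^ (-β) := by
              gcongr
              have : (0 : ℝ) ≤ F := F.2
              linarith
  refine ⟨K.toNNReal, fun n hn => (key n hn).trans_eq ?_⟩
  rw [ENNReal.ofReal_mul hK0.le]; rfl

/-! ### Inverse theorem. -/

theorem Admissible.wnorm_iterate_sub_add_le (h : Admissible p γ C) {v : ℝ} (hv : 0 < v) (k : ℕ)
    {f U : ℝ → ℝ} (hf : f ∈ wLp p γ) (hU : U ∈ wLp p γ) :
    wnorm p γ ((steklovDiff v)^[k] f) ≤ wnorm p γ ((steklovDiff v)^[k] fun x => f x - U x) +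
      wnorm p γ ((steklovDiff v)^[k] U) := by
  let f' : wLpSpace p γ := ⟨f, hf⟩
  let u : wLpSpace p γ := ⟨U, hU⟩
  have e1 := coe_one_sub_steklovEnd_pow h hv k f'
  have e2 := coe_one_sub_steklovEnd_pow h hv k u
  have e3 := coe_one_sub_steklovEnd_pow h hv k (f' - u)
  have e4 : ((f' - u : wLpSpace p γ) : ℝ → ℝ) = fun x => f x - U x := rfl
  rw [e4] at e3
  rw [show f = (f' : ℝ → ℝ) from rfl, ← e1, ← e3, show U = (u : ℝ → ℝ) from rfl, ← e2]
  refine (le_of_eq ?_).trans (wnorm_add_le h.one_le _ _)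
  rw [← map_add, sub_add_cancel]

theorem Admissible.inverse (h : Admissible p γ C) {β : ℝ} (hβ : 0 < β) {k : ℕ} (hk : β < k)
    {f : ℝ → ℝ} (hf : f ∈ wLp p γ) {C₀ : ℝ≥0}
    (hE : ∀ n : ℕ, 1 ≤ n → bestApprox n f p γ ≤ C₀ * ENNReal.ofReal ((n : ℝ) ^ (-β))) :
    ∃ K : ℝ≥0, ∀ δ : ℝ, 0 < δ → Omega k f δ p γ ≤ K * ENNReal.ofReal (δ ^ β) := by
  obtain ⟨F, hF⟩ : ∃ F : ℝ≥0, wnorm p γ f = F := ⟨_, (ENNReal.coe_toNNReal hf.2.2.ne).symm⟩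
  -- Adding 1 gives strict inequality, hence nearly best approximants.
  set E : ℝ := C₀ + 1 with hEdef
  have hE0 : 0 < E := by positivity
  have hU : ∀ j : ℕ, ∃ U ∈ trigPoly (2 ^ j),
      wnorm p γ (fun x => f x - U x) < ENNReal.ofReal (E * ((2 : ℝ) ^ j) ^ (-β)) := by
    intro j
    have h1 : bestApprox (2 ^ j) f p γ < ENNReal.ofReal (E * ((2 : ℝ) ^ j) ^ (-β)) := by
      refine (hE (2 ^ j) Nat.one_le_two_pow).trans_lt ?_
      rw [← ENNReal.ofReal_coe_nnreal, ← ENNReal.ofReal_mul C₀.coe_nonneg,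
        ENNReal.ofReal_lt_ofReal_iff (by positivity)]
      push_cast
      gcongr
      linarith
    simpa only [bestApprox, iInf_lt_iff, exists_prop] using h1
  choose U hUt hUn using hU
  have hUm : ∀ j, U j ∈ wLp p γ := fun j => h.trigPoly_mem_wLp (hUt j)
  obtain ⟨F₀, hF₀⟩ : ∃ F₀ : ℝ≥0, wnorm p γ (U 0) = F₀ :=
    ⟨_, (ENNReal.coe_toNNReal (hUm 0).2.2.ne).symm⟩
  set W : ℝ≥0 := 80 * C ^ 2 with hW
  -- By Bernstein's inequality the m-th dyadic increment contributes at most Gδ^kρ^m, and ρ > 1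
  -- because β < k.
  set ρ : ℝ := 2 ^ ((k : ℝ) - β) with hρ
  have hρ1 : 1 < ρ := Real.one_lt_rpow (by norm_num) (by linarith)
  set G : ℝ := W ^ k * 2 ^ (k + 1) * E with hG
  have hG0 : 0 ≤ G := by positivity
  set K : ℝ := W ^ k * F₀ + G / (ρ - 1) with hK
  have hρ10 : 0 < ρ - 1 := by linarith
  have hK0 : 0 ≤ K := by positivity
  -- This closes the induction on m: the bound at one level plus the new increment is at most the
  -- bound at the next level.
  have hKG : K + G ≤ K * ρ := by
    have h1 : G = G / (ρ - 1) * (ρ - 1) := by field_simp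
    have h2 : G / (ρ - 1) ≤ K := by
      have : (0 : ℝ) ≤ W ^ k * F₀ := by positivity
      linarith
    have h3 : G / (ρ - 1) * (ρ - 1) ≤ K * (ρ - 1) := by gcongr
    linarith
  have hdiff : ∀ j, wnorm p γ (fun x => U (j + 1) x - U j x) ≤
      ENNReal.ofReal (2 * E * ((2 : ℝ) ^ j) ^ (-β)) := by
    intro j
    let f' : wLpSpace p γ := ⟨f, hf⟩
    let u : ℕ → wLpSpace p γ := fun j => ⟨U j, hUm j⟩
    have h1 := wnorm_sub_le h.one_le (f' - u j) (f' - u (j + 1))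
    rw [sub_sub_sub_cancel_left] at h1
    have h2 : ((2 : ℝ) ^ (j + 1)) ^ (-β) ≤ ((2 : ℝ) ^ j) ^ (-β) :=
      Real.rpow_le_rpow_of_nonpos (by positivity)
        (pow_le_pow_right₀ (by norm_num) (Nat.le_succ j)) (by linarith)
    calc _ ≤ _ := h1
      _ ≤ ENNReal.ofReal (E * ((2 : ℝ) ^ j) ^ (-β)) + ENNReal.ofReal (E * ((2 : ℝ) ^ j) ^ (-β)) := by
        refine add_le_add (hUn j).le ((hUn (j + 1)).le.trans ?_)
        gcongr
      _ = _ := by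
        rw [← ENNReal.ofReal_add (by positivity) (by positivity)]
        congr 1; ring
  have hpoly : ∀ δ : ℝ, 0 < δ → ∀ m : ℕ,
      wnorm p γ ((steklovDiff δ)^[k] (U m)) ≤ ENNReal.ofReal (K * δ ^ k * ρ ^ m) := by
    intro δ hδ m
    have hWk : ∀ x : ℝ, 0 ≤ x →
        ((W : ℝ≥0∞) * ENNReal.ofReal x) ^ k = ENNReal.ofReal (W ^ k * x ^ k) := by
      intro x hx
      rw [← ENNReal.ofReal_coe_nnreal, ← ENNReal.ofReal_mul W.coe_nonneg, ← ENNReal.ofReal_pow (by positivity),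
        mul_pow]
    induction m with
    | zero =>
      refine (h.wnorm_steklovDiff_iterate_trigPoly_le Nat.one_le_two_pow (hUt 0) hδ k).trans ?_
      rw [hF₀, ← hW, hWk _ (by positivity), ← ENNReal.ofReal_coe_nnreal,
        ← ENNReal.ofReal_mul (by positivity)]
      refine ENNReal.ofReal_le_ofReal ?_
      have : 0 ≤ G / (ρ - 1) * δ ^ k := by positivity
      simp only [pow_zero, Nat.cast_one, mul_one]
      rw [hK]
      linarith
    | succ m ih =>
      refine (h.wnorm_iterate_sub_add_le hδ k (hUm (m + 1)) (hUm m)).trans ?_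
      have h1 := h.wnorm_steklovDiff_iterate_trigPoly_le (n := 2 ^ (m + 1)) Nat.one_le_two_pow
        (trigPoly_sub (hUt (m + 1)) (trigPoly_mono
          (Nat.pow_le_pow_right (by norm_num) (Nat.le_succ m)) (hUt m))) hδ k
      have h2 : ((2 : ℝ) ^ (m + 1)) ^ k * ((2 : ℝ) ^ m) ^ (-β) = 2 ^ k * ρ ^ m := by
        rw [hρ, ← Real.rpow_natCast _ m, ← Real.rpow_natCast _ m, ← Real.rpow_mul (by norm_num),
          ← Real.rpow_mul (by norm_num), ← pow_mul, add_mul, pow_add, one_mul,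
          ← Real.rpow_natCast 2 (m * k), mul_right_comm, ← Real.rpow_add (by norm_num), mul_comm]
        congr 2; push_cast; ring
      calc _ ≤ ENNReal.ofReal (W ^ k * (δ * (2 ^ (m + 1) : ℕ)) ^ k) *
            ENNReal.ofReal (2 * E * ((2 : ℝ) ^ m) ^ (-β)) + ENNReal.ofReal (K * δ ^ k * ρ ^ m) := by
            refine add_le_add ?_ ih
            refine h1.trans ?_
            rw [← hW, hWk _ (by positivity)]
            gcongr
            exact hdiff m
        _ = ENNReal.ofReal (G * δ ^ k * ρ ^ m + K * δ ^ k * ρ ^ m) := by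
            rw [← ENNReal.ofReal_mul (by positivity),
              ← ENNReal.ofReal_add (by positivity) (by positivity)]
            congr 2
            push_cast
            rw [mul_pow, hG, pow_succ 2 k]
            linear_combination (W ^ k * δ ^ k * 2 * E : ℝ) * h2
        _ ≤ _ := by
            refine ENNReal.ofReal_le_ofReal ?_
            calc G * δ ^ k * ρ ^ m + K * δ ^ k * ρ ^ m = (K + G) * (δ ^ k * ρ ^ m) := by ring
              _ ≤ K * ρ * (δ ^ k * ρ ^ m) := by gcongr
              _ = _ := by ring
  set B : ℝ := (1 + C) ^ k with hB
  have hBcoe : (((1 + C) ^ k : ℝ≥0) : ℝ≥0∞) = ENNReal.ofReal B := by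
    rw [hB, ← ENNReal.ofReal_coe_nnreal]; push_cast; rfl
  have hB0 : 0 ≤ B := by positivity
  set R : ℝ := B * F + B * E * 2 ^ β + K with hR
  have hR0 : 0 ≤ R := by positivity
  refine ⟨R.toNNReal, fun δ hδ => ?_⟩
  have hcoe : ((R.toNNReal : ℝ≥0) : ℝ≥0∞) = ENNReal.ofReal R := rfl
  rw [hcoe, ← ENNReal.ofReal_mul hR0, Omega]
  have hδβ : 0 < δ ^ β := by positivity
  have t1 : 0 ≤ B * F := by positivity
  have t2 : 0 ≤ B * E * 2 ^ β := by positivity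
  -- For δ ≥ 1 boundedness of (1 - T)^k suffices, as δ^β ≥ 1.
  rcases le_total 1 δ with hδ1 | hδ1
  · refine (h.wnorm_iterate_le hδ k hf).trans ?_
    rw [hBcoe, hF, ← ENNReal.ofReal_coe_nnreal, ← ENNReal.ofReal_mul hB0]
    refine ENNReal.ofReal_le_ofReal ?_
    have h1 : 1 ≤ δ ^ β := Real.one_le_rpow hδ1 hβ.le
    calc B * F ≤ R * 1 := by linarith
      _ ≤ R * δ ^ β := by gcongr
  -- The level 2^m ≤ 1/δ < 2^(m+1) balances the two terms: the approximation error 2^{-mβ} and the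
  -- smoothness bound δ^kρ^m are both of order δ^β.
  · obtain ⟨m, hm1, hm2⟩ := exists_nat_pow_near (x := 1 / δ) (y := (2 : ℝ))
      (by rw [le_div_iff₀ hδ]; linarith) (by norm_num)
    rw [le_div_iff₀ hδ] at hm1
    rw [div_lt_iff₀ hδ] at hm2
    have h1 : ((2 : ℝ) ^ m) ^ (-β) ≤ 2 ^ β * δ ^ β := by
      rw [← Real.mul_rpow (by norm_num) hδ.le, Real.rpow_neg (by positivity),
        ← Real.inv_rpow (by positivity)]
      gcongr
      rw [inv_le_iff_one_le_mul₀ (by positivity)]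
      rw [pow_succ] at hm2
      linarith
    have h2 : δ ^ k * ρ ^ m ≤ δ ^ β := by
      have e : δ ^ k * ρ ^ m = δ ^ β * (2 ^ m * δ) ^ ((k : ℝ) - β) := by
        rw [Real.mul_rpow (by positivity) hδ.le, hρ, ← Real.rpow_natCast _ m,
          ← Real.rpow_natCast _ m, ← Real.rpow_natCast _ k, ← Real.rpow_mul (by norm_num),
          ← Real.rpow_mul (by norm_num), mul_comm (m : ℝ), mul_left_comm, ← Real.rpow_add hδ,
          add_sub_cancel, mul_comm]
      rw [e]
      exact mul_le_of_le_one_right hδβ.le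
        (Real.rpow_le_one (by positivity) hm1 (by linarith))
    calc _ ≤ _ := h.wnorm_iterate_sub_add_le hδ k hf (hUm m)
      _ ≤ ENNReal.ofReal B * ENNReal.ofReal (E * ((2 : ℝ) ^ m) ^ (-β)) +
            ENNReal.ofReal (K * δ ^ k * ρ ^ m) := by
          refine add_le_add ?_ (hpoly δ hδ m)
          have hmem : (fun x => f x - U m x) ∈ wLp p γ :=
            (wLpSpace p γ).sub_mem hf (hUm m)
          refine (h.wnorm_iterate_le hδ k hmem).trans ?_
          rw [hBcoe]
          gcongr
          exact (hUn m).le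
      _ = ENNReal.ofReal (B * (E * ((2 : ℝ) ^ m) ^ (-β)) + K * δ ^ k * ρ ^ m) := by
          rw [← ENNReal.ofReal_mul hB0, ← ENNReal.ofReal_add (by positivity) (by positivity)]
      _ ≤ _ := by
          refine ENNReal.ofReal_le_ofReal ?_
          calc B * (E * ((2 : ℝ) ^ m) ^ (-β)) + K * δ ^ k * ρ ^ m
              ≤ B * (E * (2 ^ β * δ ^ β)) + K * δ ^ β := by
                rw [mul_assoc K]; gcongr
            _ = (B * E * 2 ^ β + K) * δ ^ β := by ring
            _ ≤ R * δ ^ β := by gcongr; linarith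

end WeightedTrig
end

theorem mainTheorem10 (β : ℝ) (hβ : 0 < β) (p : ℝ≥0∞) (hp : 1 ≤ p)
    (γ : ℝ → ℝ≥0∞) (hγ : WeightedTrig.ClassAS p γ)
    (f : ℝ → ℝ) (hf : f ∈ WeightedTrig.wLp p γ) :
    f ∈ WeightedTrig.LipClass β p γ ↔
      ∃ C : ℝ≥0, ∀ n : ℕ, 1 ≤ n →
        WeightedTrig.bestApprox n f p γ ≤ C * ENNReal.ofReal ((n : ℝ) ^ (-β)) := by
  obtain ⟨C, h⟩ := hγ.admissible
  constructor
  · rintro ⟨-, C₀, hΩ⟩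
    exact h.direct hβ hf hΩ
  · rintro ⟨C₀, hE⟩
    refine ⟨hf, h.inverse hβ ?_ hf hE⟩
    push_cast
    exact Nat.lt_floor_add_one β
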